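/- Let $K$ be a field of characteristic $0$, let $q=\exp(t)\in K[[t]]$, and let $k=K[q,q^{-1}]\subset K[[t]]$, with fraction field $K(q)$. Let $n\ge 0$. **Quantum group.** Let $U_q^+(sl_{n+1})_{K(q)}$ be the $K(q)$-algebra with generators $E_1,\dots,E_n$ and the quantum Serre relations $E_iE_j=E_jE_i$ for $|i-j|\ge 2$ and $E_i^2E_j-(q+q^{-1})E_iE_jE_i+E_jE_i^2=0$ for $|i-j|=1$, and let $U_q^+(sl_{n+1})$ be its $k$-subalgebra generated by $E_1,\dots,E_n$. The root vectors $e_{ij}$, $1\le i<j\le n+1$, are $e_{i,i+1}=E_i$ and $e_{ij}=e_{i,i+1}e_{i+1,j}-q^{-1}e_{i+1,j}e_{i,i+1}$ for $j>i+1$. Order the pairs by: $e_{ij}<e_{uv}$ iff $i+j<u+v$, or $i+j=u+v$ and $j<v$. **$T$-Lie algebras.** Let $R$ be a commutative ring. A $T$-Lie algebra over $R$ is a free $R$-module $L$ with a totally ordered basis $\mathcal B$, a grading $L=\bigoplus_{\eta\in\mathbb N}L_\eta$, and linear maps $S,T,\langle,\rangle:L\otimes L\to L\otimes L$, $[,]:L\otimes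 L\to L$ such that, writing $S_{12}=S\otimes Id$, $S_{23}=Id\otimes S$: (i) $S^2=Id$, and $S(x\otimes y)\in R\,(y\otimes x)$ for $x,y\in\mathcal B$; (ii) $S(Id\otimes[,])=([,]\otimes Id)S_{23}S_{12}$ and $S([,]\otimes Id)=(Id\otimes[,])S_{12}S_{23}$ on the span of all $x\otimes y\otimes z$ with $x<y<z$ in $\mathcal B$; (iii) $[L_a,L_b]\subseteq\sum_{c\le a+b-1}L_c$ and $\langle L_a\otimes L_b\rangle\subseteq\sum_{c+d\le a+b-1}L_c\otimes L_d$; (iv) $T=S+\langle,\rangle$; (v) $[,]T=-[,]$, $\langle,\rangle S=-\langle,\rangle$ and $[,]\langle,\rangle=0$; (vi) $[,]\big((Id\otimes[,])S_{12}S_{23}-([,]\otimes Id)S_{23}S_{12}+(Id\otimes[,])S_{23}S_{12}\big)=0$ on the span of all $x\otimes y\otimes z$ with $x>y>z$ in $\mathcal B$. A morphism of $T$-Lie algebras is a graded linear map commuting with $[,]$, $\langle,\rangle$ and $S$. **The algebra $(sl_{n+1}^+)_q$.** This is the free $k$-module on the symbols $e_{ij}$, $1\le i<j\le n+1$, ordered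 as above, with $\deg e_{ij}=i(j-i)$ and the following structure. For $x=e_{ab}$, $y=e_{uv}$ let $c_{x,y}$ be the integer with $[e_{aa}-e_{bb},e_{uv}]=c_{x,y}e_{uv}$, where $[,]$ is the commutator of matrix units. Put $q_{x,y}=q^{c_{x,y}}$ if $x<y$, $q_{x,y}=q^{-c_{y,x}}$ if $x>y$, $q_{x,x}=1$, and $S(x\otimes y)=q_{x,y}\,y\otimes x$. Let $[x,y]_q=[x,y]$ for $x<y$, $[x,x]_q=0$, and $[x,y]_q=-q_{x,y}[y,x]$ for $x>y$. Let $\langle e_{ij},e_{uv}\rangle=(q-q^{-1})e_{iv}\otimes e_{uj}$ if $i<u<j<v$, $\langle e_{ij},e_{uv}\rangle=(q^{-1}-q)e_{uj}\otimes e_{iv}$ if $u<i<v<j$, and $\langle e_{ij},e_{uv}\rangle=0$ otherwise. Finally $T=S+\langle,\rangle$. **The algebra $sl_{n+1}^+$.** This is the Lie algebra over $K$ of strictly upper triangular $(n+1)\times(n+1)$ matrices, with its basis of matrix units $e_{ij}$, $i<j$, in the same order and with the same degrees, regarded as $T$-Lie data by taking the commutator bracket, $\langle,\rangle=0$, and $S=T$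 the switch $x\otimes y\mapsto y\otimes x$. Then: 1. The monomials $x_1x_2\cdots x_r$ ($r\ge 0$) with $x_1\le x_2\le\dots\le x_r$ in $\{e_{ij}\mid 1\le i<j\le n+1\}$ form a free basis of the $k$-module $U_q^+(sl_{n+1})$, and likewise a $K(q)$-basis of $U_q^+(sl_{n+1})_{K(q)}$. 2. $(sl_{n+1}^+)_q$ is a $T$-Lie algebra over $k$, $sl_{n+1}^+$ is a $T$-Lie algebra over $K$, and $(sl_{n+1}^+)_q|_{t=0}=sl_{n+1}^+$: the specialization $K\otimes_k(sl_{n+1}^+)_q$ along the map $k\to K$, $t\mapsto 0$ (so $q\mapsto 1$), with the extended structure maps and grading, is isomorphic as a $T$-Lie algebra to $sl_{n+1}^+$ by the map $1\otimes e_{ij}\mapsto e_{ij}$. Thus $(sl_{n+1}^+)_q$ is a deformation of $sl_{n+1}^+$ in the category of $T$-Lie algebras. -/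

import Mathlib

open scoped TensorProduct

noncomputable section

/-! ### Basic `T`-Lie algebras -/

/-- The data of a `T`-Lie algebra over `R` with totally ordered basis indexed by `ι`: a basis,
presymmetry `S`, symmetry `T`, pseudobracket `pb`, bracket `br` and the pieces `gr d` of a grading.
The axioms are in `TLieData.IsTLie`. -/
structure TLieData (R : Type*) [CommRing R] (ι : Type*) [LinearOrder ι]
    (L : Type*) [AddCommGroup L] [Module R L] where
  basis : Module.Basis ι R L
  S : L ⊗[R] L →ₗ[R] L ⊗[R] L
  T : L ⊗[R] L →ₗ[R] L ⊗[R] L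
  pb : L ⊗[R] L →ₗ[R] L ⊗[R] L
  br : L ⊗[R] L →ₗ[R] L
  gr : ℕ → Submodule R L

namespace TLieData

variable {R : Type*} [CommRing R] {ι : Type*} [LinearOrder ι]
  {L : Type*} [AddCommGroup L] [Module R L]

/-- `S ⊗ Id` on `L ⊗ L ⊗ L` (bracketed to the right). -/
def S12 (D : TLieData R ι L) : L ⊗[R] (L ⊗[R] L) →ₗ[R] L ⊗[R] (L ⊗[R] L) :=
  (TensorProduct.assoc R L L L).toLinearMap ∘ₗ D.S.rTensor L ∘ₗ
    (TensorProduct.assoc R L L L).symm.toLinearMap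

/-- `Id ⊗ S`. -/
def S23 (D : TLieData R ι L) : L ⊗[R] (L ⊗[R] L) →ₗ[R] L ⊗[R] (L ⊗[R] L) :=
  D.S.lTensor L

/-- `[,] ⊗ Id`. -/
def brId (D : TLieData R ι L) : L ⊗[R] (L ⊗[R] L) →ₗ[R] L ⊗[R] L :=
  D.br.rTensor L ∘ₗ (TensorProduct.assoc R L L L).symm.toLinearMap

/-- `Id ⊗ [,]`. -/
def idBr (D : TLieData R ι L) : L ⊗[R] (L ⊗[R] L) →ₗ[R] L ⊗[R] L :=
  D.br.lTensor L

/-- The submodule `L³` of `L ⊗ L ⊗ L` spanned by the `x ⊗ y ⊗ z` with `x < y < z` basic. -/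
def incr3 (D : TLieData R ι L) : Submodule R (L ⊗[R] (L ⊗[R] L)) :=
  Submodule.span R {v | ∃ x y z : ι, x < y ∧ y < z ∧
    v = D.basis x ⊗ₜ[R] (D.basis y ⊗ₜ[R] D.basis z)}

/-- The submodule `³L` of `L ⊗ L ⊗ L` spanned by the `x ⊗ y ⊗ z` with `x > y > z` basic. -/
def decr3 (D : TLieData R ι L) : Submodule R (L ⊗[R] (L ⊗[R] L)) :=
  Submodule.span R {v | ∃ x y z : ι, x > y ∧ y > z ∧
    v = D.basis x ⊗ₜ[R] (D.basis y ⊗ₜ[R] D.basis z)}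

/-- The sum of the `L_d` with `d ≤ m - 1`. -/
def filtLT (D : TLieData R ι L) (m : ℕ) : Submodule R L :=
  ⨆ d : {d : ℕ // d < m}, D.gr d

/-- The sum of the `L_c ⊗ L_d` with `c + d ≤ m - 1`. -/
def filtLT₂ (D : TLieData R ι L) (m : ℕ) : Submodule R (L ⊗[R] L) :=
  ⨆ p : {p : ℕ × ℕ // p.1 + p.2 < m},
    LinearMap.range (TensorProduct.map (D.gr p.1.1).subtype (D.gr p.1.2).subtype)

/-- The axioms of a basic `T`-Lie algebra. -/
structure IsTLie (D : TLieData R ι L) : Prop where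
  S_sq : D.S ∘ₗ D.S = LinearMap.id
  S_basis : ∀ x y : ι, ∃ c : R,
    D.S (D.basis x ⊗ₜ[R] D.basis y) = c • (D.basis y ⊗ₜ[R] D.basis x)
  mult_left : ∀ v ∈ D.incr3, D.S (D.idBr v) = D.brId (D.S23 (D.S12 v))
  mult_right : ∀ v ∈ D.incr3, D.S (D.brId v) = D.idBr (D.S12 (D.S23 v))
  grading : DirectSum.IsInternal D.gr
  br_stable : ∀ c d : ℕ, ∀ a ∈ D.gr c, ∀ b ∈ D.gr d, D.br (a ⊗ₜ[R] b) ∈ D.filtLT (c + d)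
  pb_stable : ∀ c d : ℕ, ∀ a ∈ D.gr c, ∀ b ∈ D.gr d, D.pb (a ⊗ₜ[R] b) ∈ D.filtLT₂ (c + d)
  T_eq : D.T = D.S + D.pb
  br_T : D.br ∘ₗ D.T = -D.br
  pb_S : D.pb ∘ₗ D.S = -D.pb
  br_pb : D.br ∘ₗ D.pb = 0
  jacobi : ∀ v ∈ D.decr3,
    D.br (D.idBr (D.S12 (D.S23 v)) - D.brId (D.S23 (D.S12 v)) + D.idBr (D.S23 (D.S12 v))) = 0

/-- Morphisms of `T`-Lie algebras: graded linear maps commuting with bracket, pseudobracket and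
presymmetry (hence, for `T`-Lie algebras, also with the symmetry). -/
structure IsMorphism {ι' : Type*} [LinearOrder ι'] {L' : Type*} [AddCommGroup L'] [Module R L']
    (D : TLieData R ι L) (D' : TLieData R ι' L') (f : L →ₗ[R] L') : Prop where
  map_gr : ∀ d : ℕ, (D.gr d).map f ≤ D'.gr d
  map_br : f ∘ₗ D.br = D'.br ∘ₗ TensorProduct.map f f
  map_pb : TensorProduct.map f f ∘ₗ D.pb = D'.pb ∘ₗ TensorProduct.map f f
  map_S : TensorProduct.map f f ∘ₗ D.S = D'.S ∘ₗ TensorProduct.map f f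

/-- Extension of scalars `A ⊗ L`, with all structure maps extended `A`-linearly. -/
def baseChange (A : Type*) [CommRing A] [Algebra R A] (D : TLieData R ι L) :
    TLieData A ι (A ⊗[R] L) where
  basis := D.basis.baseChange A
  S := (TensorProduct.AlgebraTensorModule.distribBaseChange R A L L).toLinearMap ∘ₗ
    D.S.baseChange A ∘ₗ
    (TensorProduct.AlgebraTensorModule.distribBaseChange R A L L).symm.toLinearMap
  T := (TensorProduct.AlgebraTensorModule.distribBaseChange R A L L).toLinearMap ∘ₗ
    D.T.baseChange A ∘ₗ
    (TensorProduct.AlgebraTensorModule.distribBaseChange R A L L).symm.toLinearMap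
  pb := (TensorProduct.AlgebraTensorModule.distribBaseChange R A L L).toLinearMap ∘ₗ
    D.pb.baseChange A ∘ₗ
    (TensorProduct.AlgebraTensorModule.distribBaseChange R A L L).symm.toLinearMap
  br := D.br.baseChange A ∘ₗ
    (TensorProduct.AlgebraTensorModule.distribBaseChange R A L L).symm.toLinearMap
  gr := fun d => (D.gr d).baseChange A

/-- The `T`-Lie data of a classical Lie algebra with an ordered basis and degrees `η` of the basic
elements: the Lie bracket, zero pseudobracket, and `S = T` the usual switch. -/
def classical {𝔤 : Type*} [LieRing 𝔤] [LieAlgebra R 𝔤] (b : Module.Basis ι R 𝔤) (η : ι → ℕ) :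
    TLieData R ι 𝔤 where
  basis := b
  S := (TensorProduct.comm R 𝔤 𝔤).toLinearMap
  T := (TensorProduct.comm R 𝔤 𝔤).toLinearMap
  pb := 0
  br := (LieModule.toModuleHom R 𝔤 𝔤 : 𝔤 ⊗[R] 𝔤 →ₗ[R] 𝔤)
  gr := fun d => Submodule.span R (b '' {x | η x = d})

/-- `D` over `R` is a deformation, in the category of `T`-Lie algebras, of `D₀` over the
`R`-algebra `A`: both are `T`-Lie algebras, and the specialization `A ⊗ L` of `D` is isomorphic as a
`T`-Lie algebra to `D₀` by an isomorphism matching the given ordered bases. -/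
def IsDeformation {A : Type*} [CommRing A] [Algebra R A]
    {L₀ : Type*} [AddCommGroup L₀] [Module A L₀]
    (D : TLieData R ι L) (D₀ : TLieData A ι L₀) : Prop :=
  D.IsTLie ∧ D₀.IsTLie ∧ ∃ f : (A ⊗[R] L) ≃ₗ[A] L₀,
    (∀ x : ι, f (1 ⊗ₜ[R] D.basis x) = D₀.basis x) ∧
    IsMorphism (D.baseChange A) D₀ f.toLinearMap ∧
    IsMorphism D₀ (D.baseChange A) f.symm.toLinearMap

end TLieData

/-! ### Positive roots of type `A_n` -/

/-- The pairs `(i, j)` with `i < j` in `{0, …, n}`. The pair `(i, j)` stands for the matrix unit or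
root vector usually written with indices `i + 1`, `j + 1` in `{1, …, n + 1}`. -/
def PosRoot (n : ℕ) : Type := {p : Fin (n + 1) × Fin (n + 1) // p.1 < p.2}

namespace PosRoot

variable {n : ℕ}

instance : Fintype (PosRoot n) :=
  inferInstanceAs (Fintype {p : Fin (n + 1) × Fin (n + 1) // p.1 < p.2})

/-- row index -/
def row (p : PosRoot n) : Fin (n + 1) := p.1.1

/-- column index -/
def col (p : PosRoot n) : Fin (n + 1) := p.1.2

theorem row_lt_col (p : PosRoot n) : p.row < p.col := p.2

/-- `(i + j, j)`, to be compared lexicographically. -/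
def key (p : PosRoot n) : ℕ ×ₗ ℕ := toLex ((p.row : ℕ) + (p.col : ℕ), (p.col : ℕ))

theorem key_injective : Function.Injective (key (n := n)) := by
  rintro ⟨⟨a, b⟩, h⟩ ⟨⟨c, d⟩, h'⟩ e
  have e' : ((a : ℕ) + (b : ℕ), (b : ℕ)) = ((c : ℕ) + (d : ℕ), (d : ℕ)) := toLex.injective e
  rw [Prod.mk.injEq] at e'
  have h1 : a = c := Fin.ext (by omega)
  have h2 : b = d := Fin.ext (by omega)
  subst h1; subst h2; rfl

/-- `e_{ij} < e_{uv}` iff `i + j < u + v`, or `i + j = u + v` and `j < v`. -/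
instance : LinearOrder (PosRoot n) := LinearOrder.lift' key key_injective

/-- The degree `η(e_{ij}) = i (j - i)` (with `i`, `j` counted from `1`). -/
def deg (p : PosRoot n) : ℕ := ((p.row : ℕ) + 1) * ((p.col : ℕ) - (p.row : ℕ))

/-- The integer `c` with `[h, e_{uv}] = c e_{uv}`, where `h = [e_{ab}, e_{ab}ᵗ] = e_{aa} - e_{bb}`,
`(a, b) = x`, `(u, v) = y`. -/
def cartan (x y : PosRoot n) : ℤ :=
  (if y.row = x.row then 1 else 0) - (if y.col = x.row then 1 else 0)
    - (if y.row = x.col then 1 else 0) + (if y.col = x.col then 1 else 0)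

/-- The scalar `q_{x,y}` of the presymmetry: `q ^ c(x,y)` for `x < y`, its inverse counterpart for
`x > y`, and `1` for `x = y`. -/
def qcoef {R : Type*} [CommRing R] (q : Rˣ) (x y : PosRoot n) : R :=
  if x < y then ((q ^ cartan x y : Rˣ) : R)
  else if y < x then ((q ^ (-cartan y x) : Rˣ) : R)
  else 1

/-- The basis element `e_{ij}` of the free module on the positive roots; `0` if not `i < j`. -/
def unit (R : Type*) [CommRing R] (i j : Fin (n + 1)) : PosRoot n →₀ R :=
  if h : i < j then Finsupp.single ⟨(i, j), h⟩ 1 else 0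

/-- The usual bracket `[e_{ij}, e_{uv}] = δ_{ju} e_{iv} - δ_{vi} e_{uj}` of matrix units. -/
def usualBr (R : Type*) [CommRing R] (x y : PosRoot n) : PosRoot n →₀ R :=
  (if x.col = y.row then unit R x.row y.col else 0)
    - (if y.col = x.row then unit R y.row x.col else 0)

/-- The `q`-bracket on basic elements: the usual bracket for `x < y`, extended by
`[x, y] = - q_{x,y} [y, x]` and `[x, x] = 0`. -/
def qBr {R : Type*} [CommRing R] (q : Rˣ) (x y : PosRoot n) : PosRoot n →₀ R :=
  if x < y then usualBr R x y
  else if y < x then -(qcoef q x y • usualBr R y x)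
  else 0

/-- The pseudobracket `⟨e_{ij}, e_{uv}⟩`. -/
def qPb {R : Type*} [CommRing R] (q : Rˣ) (x y : PosRoot n) :
    (PosRoot n →₀ R) ⊗[R] (PosRoot n →₀ R) :=
  if x.row < y.row ∧ y.row < x.col ∧ x.col < y.col then
    ((q : R) - ((q⁻¹ : Rˣ) : R)) • (unit R x.row y.col ⊗ₜ[R] unit R y.row x.col)
  else if y.row < x.row ∧ x.row < y.col ∧ y.col < x.col then
    (((q⁻¹ : Rˣ) : R) - (q : R)) • (unit R y.row x.col ⊗ₜ[R] unit R x.row y.col)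
  else 0

end PosRoot

/-- The basis `x ⊗ y` of the tensor square of the free module on the positive roots. -/
def rootBasis₂ (R : Type*) [CommRing R] (n : ℕ) :
    Module.Basis (PosRoot n × PosRoot n) R ((PosRoot n →₀ R) ⊗[R] (PosRoot n →₀ R)) :=
  (Finsupp.basisSingleOne (R := R) (ι := PosRoot n)).tensorProduct Finsupp.basisSingleOne

/-- The `T`-Lie data `(sl_{n+1}^+)_q` over a commutative ring `R` with a unit `q`. -/
def slPlusQ {R : Type*} [CommRing R] (q : Rˣ) (n : ℕ) :
    TLieData R (PosRoot n) (PosRoot n →₀ R) where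
  basis := Finsupp.basisSingleOne
  S := (rootBasis₂ R n).constr R fun p =>
    p.1.qcoef q p.2 • (Finsupp.single p.2 (1 : R) ⊗ₜ[R] Finsupp.single p.1 (1 : R))
  T := ((rootBasis₂ R n).constr R fun p =>
      p.1.qcoef q p.2 • (Finsupp.single p.2 (1 : R) ⊗ₜ[R] Finsupp.single p.1 (1 : R)))
    + (rootBasis₂ R n).constr R fun p => p.1.qPb q p.2
  pb := (rootBasis₂ R n).constr R fun p => p.1.qPb q p.2
  br := (rootBasis₂ R n).constr R fun p => p.1.qBr q p.2
  gr := fun d => Submodule.span R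
    ((fun x : PosRoot n => Finsupp.single x (1 : R)) '' {x | x.deg = d})

/-! ### The classical Lie algebra `sl_{n+1}^+` -/

attribute [local instance 100] LieRing.ofAssociativeRing

/-- `sl_{n+1}^+`: the Lie algebra of strictly upper triangular matrices of size `n + 1`. -/
def slPlus (K : Type*) [Field K] (n : ℕ) :
    LieSubalgebra K (Matrix (Fin (n + 1)) (Fin (n + 1)) K) where
  carrier := {M | ∀ i j, j ≤ i → M i j = 0}
  zero_mem' := fun _ _ _ => rfl
  add_mem' := by
    intro a b ha hb i j h
    simp [ha i j h, hb i j h]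
  smul_mem' := by
    intro c a ha i j h
    simp [ha i j h]
  lie_mem' := by
    have key : ∀ a b : Matrix (Fin (n + 1)) (Fin (n + 1)) K,
        (∀ i j, j ≤ i → a i j = 0) → (∀ i j, j ≤ i → b i j = 0) →
        ∀ i j, j ≤ i → (a * b) i j = 0 := by
      intro a b ha hb i j h
      rw [Matrix.mul_apply]
      refine Finset.sum_eq_zero fun l _ => ?_
      by_cases hl : l ≤ i
      · rw [ha i l hl, zero_mul]
      · rw [hb l j (h.trans (not_le.mp hl).le), mul_zero]
    intro a b ha hb i j h
    change (a * b - b * a) i j = 0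
    rw [Matrix.sub_apply, key a b ha hb i j h, key b a hb ha i j h, sub_zero]

/-- The matrix entries above the diagonal are coordinates on `sl_{n+1}^+`. -/
def slPlusEquiv (K : Type*) [Field K] (n : ℕ) : slPlus K n ≃ₗ[K] (PosRoot n → K) where
  toFun := fun M p => M.1 p.row p.col
  map_add' := fun _ _ => rfl
  map_smul' := fun _ _ => rfl
  invFun := fun g => ⟨fun i j => if h : i < j then g ⟨(i, j), h⟩ else 0,
    fun _ _ h => dif_neg (not_lt.mpr h)⟩
  left_inv := by
    intro M
    apply Subtype.ext
    funext i j
    by_cases h : i < j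
    · exact dif_pos h
    · exact (dif_neg h).trans (M.2 i j (not_lt.mp h)).symm
  right_inv := by
    intro g
    funext p
    exact dif_pos p.2

/-- The basis of matrix units `e_{ij}`, `i < j`, of `sl_{n+1}^+`. -/
def slPlusBasis (K : Type*) [Field K] (n : ℕ) : Module.Basis (PosRoot n) K (slPlus K n) :=
  Module.Basis.ofEquivFun (slPlusEquiv K n)

theorem slPlusBasis_coe (K : Type*) [Field K] (n : ℕ) (p : PosRoot n) :
    (slPlusBasis K n p : Matrix (Fin (n + 1)) (Fin (n + 1)) K) = Matrix.single p.row p.col 1 := by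
  classical
  rw [slPlusBasis, Module.Basis.coe_ofEquivFun]
  funext i j
  change (if h : i < j then (Pi.single p (1 : K) : PosRoot n → K) ⟨(i, j), h⟩ else 0) = _
  rw [Matrix.single_apply]
  by_cases e : p.row = i ∧ p.col = j
  · obtain ⟨rfl, rfl⟩ := e
    rw [dif_pos p.row_lt_col, if_pos ⟨rfl, rfl⟩]
    exact Pi.single_eq_same p 1
  · rw [if_neg e]
    split_ifs with h
    · refine Pi.single_eq_of_ne (fun hp => e ?_) 1
      rw [← hp]
      exact ⟨rfl, rfl⟩
    · rfl

/-! ### The ground ring `k = K[q, q⁻¹]` with `q = exp t` -/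

/-- `K[q, q⁻¹]` as a subalgebra of `K⟦t⟧`, where `q = exp t`. -/
def qSubalgebra (K : Type*) [Field K] [CharZero K] : Subalgebra K (PowerSeries K) :=
  Algebra.adjoin K {PowerSeries.exp K, PowerSeries.evalNegHom (PowerSeries.exp K)}

/-- The ring `k = K[q, q⁻¹] ⊆ K⟦t⟧`, where `q = exp t`. -/
def QRing (K : Type*) [Field K] [CharZero K] : Type _ := qSubalgebra K

instance (K : Type*) [Field K] [CharZero K] : CommRing (QRing K) :=
  inferInstanceAs (CommRing (qSubalgebra K))

instance (K : Type*) [Field K] [CharZero K] : IsDomain (QRing K) :=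
  inferInstanceAs (IsDomain (qSubalgebra K))

instance (K : Type*) [Field K] [CharZero K] : Algebra K (QRing K) :=
  inferInstanceAs (Algebra K (qSubalgebra K))

/-- The unit `q = exp t` of `k`, with inverse `exp (-t)`. -/
def qUnit (K : Type*) [Field K] [CharZero K] : (QRing K)ˣ where
  val := (⟨PowerSeries.exp K, Algebra.subset_adjoin (Or.inl rfl)⟩ : qSubalgebra K)
  inv := (⟨PowerSeries.evalNegHom (PowerSeries.exp K),
    Algebra.subset_adjoin (Or.inr rfl)⟩ : qSubalgebra K)
  val_inv := Subtype.ext PowerSeries.exp_mul_exp_neg_eq_one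
  inv_val := Subtype.ext ((mul_comm _ _).trans PowerSeries.exp_mul_exp_neg_eq_one)

/-- The specialization `t = 0`, sending a power series to its constant coefficient. -/
def atZero (K : Type*) [Field K] [CharZero K] : QRing K →+* K :=
  (PowerSeries.constantCoeff (R := K)).comp (qSubalgebra K).val.toRingHom

/-- `K` as a `k`-algebra through the specialization `t = 0`. -/
instance (K : Type*) [Field K] [CharZero K] : Algebra (QRing K) K := (atZero K).toAlgebra

/-! ### The positive part of the Drinfeld–Jimbo quantum group of type `A_n` -/

/-- The quantum Serre relations of type `A_n`. -/
inductive SerreRel {R : Type*} [CommRing R] (q : Rˣ) (n : ℕ) :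
    FreeAlgebra R (Fin n) → FreeAlgebra R (Fin n) → Prop
  | comm (i j : Fin n) (h : (i : ℕ) + 1 < (j : ℕ)) :
      SerreRel q n (FreeAlgebra.ι R i * FreeAlgebra.ι R j) (FreeAlgebra.ι R j * FreeAlgebra.ι R i)
  | serre (i j : Fin n) (h : (i : ℕ) + 1 = (j : ℕ) ∨ (j : ℕ) + 1 = (i : ℕ)) :
      SerreRel q n
        (FreeAlgebra.ι R i * FreeAlgebra.ι R i * FreeAlgebra.ι R j
          - ((q : R) + ((q⁻¹ : Rˣ) : R)) •
            (FreeAlgebra.ι R i * FreeAlgebra.ι R j * FreeAlgebra.ι R i)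
          + FreeAlgebra.ι R j * FreeAlgebra.ι R i * FreeAlgebra.ι R i)
        0

/-- The field `K(q)` of fractions of `k`. -/
def QField (K : Type*) [Field K] [CharZero K] : Type _ := FractionRing (QRing K)

instance (K : Type*) [Field K] [CharZero K] : Field (QField K) :=
  inferInstanceAs (Field (FractionRing (QRing K)))

instance (K : Type*) [Field K] [CharZero K] : Algebra (QRing K) (QField K) :=
  inferInstanceAs (Algebra (QRing K) (FractionRing (QRing K)))

instance (K : Type*) [Field K] [CharZero K] : IsFractionRing (QRing K) (QField K) :=
  inferInstanceAs (IsFractionRing (QRing K) (FractionRing (QRing K)))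

/-- `q` as a unit of `K(q)`. -/
def qUnitField (K : Type*) [Field K] [CharZero K] : (QField K)ˣ :=
  Units.map (algebraMap (QRing K) (QField K)).toMonoidHom (qUnit K)

/-- `U_q^+(sl_{n+1})` over the field `K(q)`. -/
def UqPlusField (K : Type*) [Field K] [CharZero K] (n : ℕ) : Type _ :=
  RingQuot (SerreRel (qUnitField K) n)

instance (K : Type*) [Field K] [CharZero K] (n : ℕ) : Ring (UqPlusField K n) :=
  inferInstanceAs (Ring (RingQuot (SerreRel (qUnitField K) n)))

instance (K : Type*) [Field K] [CharZero K] (n : ℕ) : Algebra (QField K) (UqPlusField K n) :=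
  inferInstanceAs (Algebra (QField K) (RingQuot (SerreRel (qUnitField K) n)))

instance (K : Type*) [Field K] [CharZero K] (n : ℕ) : Algebra (QRing K) (UqPlusField K n) :=
  inferInstanceAs (Algebra (QRing K) (RingQuot (SerreRel (qUnitField K) n)))

instance (K : Type*) [Field K] [CharZero K] (n : ℕ) :
    IsScalarTower (QRing K) (QField K) (UqPlusField K n) :=
  inferInstanceAs (IsScalarTower (QRing K) (QField K) (RingQuot (SerreRel (qUnitField K) n)))

/-- The Chevalley generators over `K(q)`. -/
def UqPlusField.gen (K : Type*) [Field K] [CharZero K] (n : ℕ) (i : Fin n) : UqPlusField K n :=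
  RingQuot.mkAlgHom (QField K) (SerreRel (qUnitField K) n) (FreeAlgebra.ι (QField K) i)

/-- The `k`-subalgebra of `U_q^+(sl_{n+1})` over `K(q)` generated by the Chevalley generators. -/
def uqPlusForm (K : Type*) [Field K] [CharZero K] (n : ℕ) :
    Subalgebra (QRing K) (UqPlusField K n) :=
  Algebra.adjoin (QRing K) (Set.range (UqPlusField.gen K n))

/-- `U_q^+(sl_{n+1})` over `k = K[q, q⁻¹]`. -/
def UqPlus (K : Type*) [Field K] [CharZero K] (n : ℕ) : Type _ := uqPlusForm K n

instance (K : Type*) [Field K] [CharZero K] (n : ℕ) : Ring (UqPlus K n) :=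
  inferInstanceAs (Ring (uqPlusForm K n))

instance (K : Type*) [Field K] [CharZero K] (n : ℕ) : Algebra (QRing K) (UqPlus K n) :=
  inferInstanceAs (Algebra (QRing K) (uqPlusForm K n))

/-- The Chevalley generators, in the `k`-form. -/
def UqPlus.gen (K : Type*) [Field K] [CharZero K] (n : ℕ) (i : Fin n) : UqPlus K n :=
  (⟨UqPlusField.gen K n i, Algebra.subset_adjoin ⟨i, rfl⟩⟩ : uqPlusForm K n)

/-- `rootAux r E d i` is the root vector `e_{i, i+d+1}`: it is `E i` for `d = 0`, and
`e_{i,j} = e_{i,i+1} e_{i+1,j} - r e_{i+1,j} e_{i,i+1}` otherwise. -/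
def rootAux {R A : Type*} [CommRing R] [Ring A] [Algebra R A] (r : R) (E : ℕ → A) : ℕ → ℕ → A
  | 0, i => E i
  | d + 1, i => E i * rootAux r E d (i + 1) - r • (rootAux r E d (i + 1) * E i)

/-- The root vector `e_{ij}` built from generators `e_{i,i+1} = E i`, with `r = q⁻¹`. -/
def rootVector {R A : Type*} [CommRing R] [Ring A] [Algebra R A] {n : ℕ} (r : R) (E : Fin n → A)
    (p : PosRoot n) : A :=
  rootAux r (fun i => if h : i < n then E ⟨i, h⟩ else 0) ((p.col : ℕ) - (p.row : ℕ) - 1) p.row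

/-- Finite non-decreasing sequences of positive roots (including the empty one). -/
abbrev NondecSeq (n : ℕ) : Type := {l : List (PosRoot n) // l.Pairwise (· ≤ ·)}

end

/-!
The theorem has two independent halves.

**PBW bases.** Spanning is a straightening argument. From the quantum Serre relations one derives
the commutation relations of all root vectors (`IsQuantumSerre.rootVec_split`, `commute_of_nested`,
`qCommute_of_row_eq`, `qCommute_of_col_eq`, `commutator_of_crossing`). They say that any two root
vectors commute up to a unit and up to words of smaller total degree, for the degree
`e_{ij} ↦ i (j - i)` of the `T`-Lie algebra. Hence each word equals a unit times its sorted
rearrangement, up to words of smaller degree, and induction on the degree applies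
(`prod_mem_span_sorted`). The only denominator needed is `q + q⁻¹`, and it is not needed in the
coefficients: it suffices that `q + q⁻¹` is not a zero divisor on the algebra, so the argument works
over `k` as well as over `K(q)`.

Linear independence uses Feigin's map to a quantum polynomial ring. Take variables `X (a, i)`, with
a level `a < n` and a simple root `i`, that commute up to powers of `q` given by the Cartan matrix
and an order of the variables. Then `E_i ↦ ∑ₐ X (a, i)` satisfies the quantum Serre relations, and the
root vector `e_{ij}` goes to `(1 - q⁻²) ^ (j - i - 1)` times the sum of all products
`X (a₀, i) X (a₁, i + 1) ⋯` with `a₀ < a₁ < ⋯` (`IsFeiginFamily.rootAux_eq_chainSum`). Give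
`X (a, i)` the weight `a`. The part of lowest weight of this sum is the single monomial with
`a₀ = 0, a₁ = 1, …`, so an ordered monomial in the root vectors has a single monomial as its part of
lowest weight, and the exponent of that monomial determines the multiplicity of each root
(`sum_rootExp_injective`). The quantum polynomial ring is realized by operators on a free module,
and independence is tested on the vector `1`. Independence over `k` follows from that over `K(q)`.

**The deformation.** The axioms for `(sl_{n+1}^+)_q` hold over any commutative ring with a unit `q`
and are checked on basis elements. The order of the roots is convex (`PosRoot.lt_join`,
`PosRoot.join_lt`), the Cartan pairing is additive in each argument, and for `z < y < x` the Jacobi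
identity reduces to `[[z, y], x] = [z, [y, x]]` together with `[y, [z, x]] = 0`
(`TLieData.jacobi_of_assoc`). When `q` specializes to `1`, all the scalars `q_{x,y}` become `1` and
the pseudobracket, a multiple of `q - q⁻¹`, vanishes, which leaves the commutator of matrix units.
-/

/-! ### Root vectors and their commutation relations -/

section RootVectors

variable {R A : Type*} [CommRing R] [Ring A] [Algebra R A]

/-- The `r`-commutator `ab - r ba`. -/
def qComm (r : R) (a b : A) : A := a * b - r • (b * a)

/-- `a` and `b` commute up to the scalar `c`: `ab = c ba`. -/
def QCommute (c : R) (a b : A) : Prop := a * b = c • (b * a)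

theorem Commute.qCommute {a b : A} (h : Commute a b) : QCommute (1 : R) a b := by
  rw [QCommute, one_smul]; exact h

theorem QCommute.commute {a b : A} (h : QCommute (1 : R) a b) : Commute a b := by
  rw [QCommute, one_smul] at h; exact h

theorem QCommute.qComm_right {c d r : R} {x a b : A} (ha : QCommute c x a) (hb : QCommute d x b) :
    QCommute (c * d) x (qComm r a b) := by
  unfold QCommute at *
  have h1 : x * (a * b) = (c * d) • (a * b * x) := by
    rw [← mul_assoc, ha, smul_mul_assoc, mul_assoc, hb, mul_smul_comm, smul_smul, mul_assoc]
  have h2 : x * (b * a) = (c * d) • (b * a * x) := by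
    rw [← mul_assoc, hb, smul_mul_assoc, mul_assoc, ha, mul_smul_comm, smul_smul, mul_assoc,
      mul_comm d]
  rw [qComm, mul_sub, sub_mul, mul_smul_comm, h1, h2, smul_mul_assoc, smul_sub, smul_comm r]

theorem QCommute.qComm_left {c d r : R} {x a b : A} (ha : QCommute c a x) (hb : QCommute d b x) :
    QCommute (c * d) (qComm r a b) x := by
  unfold QCommute at *
  have h1 : a * b * x = (c * d) • (x * (a * b)) := by
    rw [mul_assoc, hb, mul_smul_comm, ← mul_assoc, ha, smul_mul_assoc, smul_smul, mul_assoc,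
      mul_comm d]
  have h2 : b * a * x = (c * d) • (x * (b * a)) := by
    rw [mul_assoc, ha, mul_smul_comm, ← mul_assoc, hb, smul_mul_assoc, smul_smul, mul_assoc]
  rw [qComm, mul_sub, sub_mul, mul_smul_comm, h1, smul_mul_assoc, h2, smul_sub, smul_comm r]

theorem Commute.qComm_right {r : R} {x a b : A} (ha : Commute x a) (hb : Commute x b) :
    Commute x (qComm r a b) := by
  have := ha.qCommute (R := R) |>.qComm_right (r := r) hb.qCommute
  rw [one_mul] at this
  exact this.commute

/-- The `r`-commutator is associative on triples whose outer members commute. -/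
theorem qComm_assoc {r : R} {a b c : A} (h : Commute a c) :
    qComm r (qComm r a b) c = qComm r a (qComm r b c) := by
  have h1 : b * a * c = b * c * a := by rw [mul_assoc, h.eq, mul_assoc]
  have h2 : c * (a * b) = a * (c * b) := by rw [← mul_assoc, ← h.eq, mul_assoc]
  simp only [qComm, mul_sub, sub_mul, smul_mul_assoc, mul_smul_comm, smul_sub]
  rw [h1, h2, ← mul_assoc c b a, ← mul_assoc a b c]
  abel

/-- A sequence of elements of an algebra satisfying the quantum Serre relations of type `A`. -/
structure IsQuantumSerre (q : Rˣ) (E : ℕ → A) : Prop where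
  comm : ∀ i j, i + 1 < j → Commute (E i) (E j)
  serre : ∀ i j, i + 1 = j ∨ j + 1 = i →
    E i * E i * E j - ((q : R) + ((q⁻¹ : Rˣ) : R)) • (E i * E j * E i) + E j * E i * E i = 0

/-- The root vector `e_{ij}` of a sequence `E`, with natural number indices `i < j`. -/
def rootVec (r : R) (E : ℕ → A) (i j : ℕ) : A := rootAux r E (j - i - 1) i

theorem rootVec_succ (r : R) (E : ℕ → A) (i : ℕ) : rootVec r E i (i + 1) = E i := by
  simp [rootVec, rootAux]

theorem rootVec_eq_qComm (r : R) (E : ℕ → A) {i j : ℕ} (h : i + 1 < j) :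
    rootVec r E i j = qComm r (E i) (rootVec r E (i + 1) j) := by
  obtain ⟨d, rfl⟩ : ∃ d, j = i + 1 + d + 1 := ⟨j - i - 2, by omega⟩
  have h1 : i + 1 + d + 1 - i - 1 = d + 1 := by omega
  have h2 : i + 1 + d + 1 - (i + 1) - 1 = d := by omega
  rw [rootVec, rootVec, h1, h2, rootAux, qComm]

/-- Whatever commutes with the generators `E_i, …, E_{j-1}` commutes with `e_{ij}`. -/
theorem commute_rootVec {r : R} {E : ℕ → A} {x : A} {i j : ℕ} (hij : i < j)
    (h : ∀ k, i ≤ k → k < j → Commute x (E k)) : Commute x (rootVec r E i j) := by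
  induction hd : j - i generalizing i with
  | zero => omega
  | succ d ih =>
    rcases Nat.lt_or_ge (i + 1) j with h1 | h1
    · rw [rootVec_eq_qComm r E h1]
      exact (h i le_rfl hij).qComm_right
        (ih h1 (fun k hk hk' => h k (by omega) hk') (by omega))
    · obtain rfl : j = i + 1 := by omega
      rw [rootVec_succ]
      exact h i le_rfl hij

namespace IsQuantumSerre

variable {q : Rˣ} {E : ℕ → A}

local notation "p" => ((q⁻¹ : Rˣ) : R)

theorem commute_of_far (hE : IsQuantumSerre q E) {i j k : ℕ} (hij : i < j)
    (h : k + 1 < i ∨ j < k) : Commute (E k) (rootVec p E i j) := by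
  refine commute_rootVec hij fun l hl hl' => ?_
  rcases h with h | h
  · exact hE.comm _ _ (by omega)
  · exact (hE.comm _ _ (by omega)).symm

theorem commute_rootVec_of_lt (hE : IsQuantumSerre q E) {i j u v : ℕ} (hij : i < j) (hju : j < u)
    (huv : u < v) : Commute (rootVec p E i j) (rootVec p E u v) :=
  commute_rootVec huv fun _ hl _ => (hE.commute_of_far hij (Or.inr (by omega))).symm

/-- A root vector can be split at any intermediate index. -/
theorem rootVec_split (hE : IsQuantumSerre q E) {i j k : ℕ} (hik : i < k) (hkj : k < j) :
    rootVec p E i j = qComm p (rootVec p E i k) (rootVec p E k j) := by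
  induction hd : k - i generalizing i with
  | zero => omega
  | succ d ih =>
    rcases Nat.lt_or_ge (i + 1) k with h1 | h1
    · rw [rootVec_eq_qComm _ _ (by omega : i + 1 < j), ih h1 (by omega), rootVec_eq_qComm _ _ h1,
        qComm_assoc (hE.commute_of_far hkj (Or.inl h1))]
    · obtain rfl : k = i + 1 := by omega
      rw [rootVec_eq_qComm _ _ hkj, rootVec_succ]

/-- One Serre relation, read as a `q`-commutation of `E_i` with `e_{i,i+2}`. -/
theorem gen_rootVec_two (hE : IsQuantumSerre q E) (i : ℕ) :
    QCommute (q : R) (E i) (rootVec p E i (i + 2)) := by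
  have h := hE.serre i (i + 1) (Or.inl rfl)
  rw [rootVec_eq_qComm _ _ (by omega), rootVec_succ, QCommute, qComm]
  simp only [mul_sub, sub_mul, smul_mul_assoc, mul_smul_comm, smul_sub, smul_smul, Units.mul_inv,
    one_smul, ← mul_assoc]
  rw [← sub_eq_zero, ← h]
  module

/-- The other Serre relation, read as a `q`-commutation of `e_{i,i+2}` with `E_{i+1}`. -/
theorem rootVec_two_gen (hE : IsQuantumSerre q E) (i : ℕ) :
    QCommute (q : R) (rootVec p E i (i + 2)) (E (i + 1)) := by
  have h := hE.serre (i + 1) i (Or.inr rfl)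
  rw [rootVec_eq_qComm _ _ (by omega), rootVec_succ, QCommute, qComm]
  simp only [mul_sub, sub_mul, smul_mul_assoc, mul_smul_comm, smul_sub, smul_smul, Units.mul_inv,
    one_smul, ← mul_assoc]
  rw [← sub_eq_zero, ← h]
  module

theorem gen_rootVec (hE : IsQuantumSerre q E) {i j : ℕ} (h : i + 1 < j) :
    QCommute (q : R) (E i) (rootVec p E i j) := by
  rcases (Nat.succ_le_of_lt h).eq_or_lt with rfl | h2
  · exact hE.gen_rootVec_two i
  · rw [hE.rootVec_split (by omega : i < i + 2) h2, ← mul_one (q : R)]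
    exact (hE.gen_rootVec_two i).qComm_right (hE.commute_of_far h2 (Or.inl (by omega))).qCommute

theorem rootVec_gen (hE : IsQuantumSerre q E) {i j : ℕ} (h : i < j) :
    QCommute (q : R) (rootVec p E i (j + 1)) (E j) := by
  rcases (Nat.succ_le_of_lt h).eq_or_lt with rfl | h2
  · exact hE.rootVec_two_gen i
  · obtain ⟨k, rfl⟩ : ∃ k, j = k + 1 := ⟨j - 1, by omega⟩
    rw [hE.rootVec_split (by omega : i < k) (by omega), ← one_mul (q : R)]
    exact ((hE.commute_of_far (by omega) (Or.inr (by omega))).symm.qCommute).qComm_left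
      (hE.rootVec_two_gen k)

end IsQuantumSerre

section TripleCommutator

variable {q : Rˣ} {a b c : A}

local notation "p" => ((q⁻¹ : Rˣ) : R)

/-- If `x` `q`-commutes with `b`, the failure of `b` to commute with `[x, c]_p` is governed by the
commutator of `x` with `[b, c]_p`. -/
theorem commutator_qComm_right {x : A} (h : QCommute (q : R) x b) :
    b * qComm p x c - qComm p x c * b =
      p • (x * qComm p b c - qComm p b c * x - ((q : R) - p) • (qComm p x c * b)) := by
  have h3 : b * x = p • (x * b) := by rw [h, smul_smul, Units.inv_mul, one_smul]
  have e1 : b * (x * c) = p • (x * (b * c)) := by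
    rw [← mul_assoc, h3, smul_mul_assoc, mul_assoc]
  have e2 : c * (b * x) = p • (c * (x * b)) := by rw [h3, mul_smul_comm]
  simp only [qComm, mul_sub, sub_mul, smul_mul_assoc, mul_smul_comm, smul_sub, mul_assoc, e1, e2]
  have hq : p * (q : R) = 1 := Units.inv_mul q
  match_scalars
  · ring
  · ring
  · linear_combination hq
  · linear_combination (-p) * hq

/-- If `b` `q`-commutes with `z`, the failure of `b` to commute with `[a, z]_p` is governed by the
commutator of `[a, b]_p` with `z`. -/
theorem commutator_qComm_left {z : A} (h : QCommute (q : R) b z) :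
    b * qComm p a z - qComm p a z * b =
      p • (((q : R) - p) • (b * qComm p a z) - (qComm p a b * z - z * qComm p a b)) := by
  have h3 : z * b = p • (b * z) := by rw [h, smul_smul, Units.inv_mul, one_smul]
  have e1 : z * (b * a) = p • (b * (z * a)) := by
    rw [← mul_assoc, h3, smul_mul_assoc, mul_assoc]
  have e2 : a * (z * b) = p • (a * (b * z)) := by rw [h3, mul_smul_comm]
  simp only [qComm, mul_sub, sub_mul, smul_mul_assoc, mul_smul_comm, smul_sub, mul_assoc, e1, e2]
  have hq : p * (q : R) = 1 := Units.inv_mul q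
  match_scalars
  · linear_combination -hq
  · linear_combination p * hq
  · ring
  · ring

/-- Averaging the two expressions for the commutator of `b` with the triple commutator
`[[a, b]_p, c]_p = [a, [b, c]_p]_p` shows that it is killed by `q + q⁻¹`. -/
theorem commute_triple (h2 : ∀ y : A, ((q : R) + p) • y = 0 → y = 0) (hac : Commute a c)
    (h : QCommute (q : R) (qComm p a b) b) (h' : QCommute (q : R) b (qComm p b c)) :
    Commute b (qComm p (qComm p a b) c) := by
  have e1 := commutator_qComm_right (c := c) h
  have e2 := commutator_qComm_left (a := a) h'
  rw [← qComm_assoc hac] at e2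
  generalize qComm p (qComm p a b) c = x at *
  generalize qComm p a b * qComm p b c - qComm p b c * qComm p a b = w at *
  have hq : p * (q : R) = 1 := Units.inv_mul q
  refine sub_eq_zero.mp (h2 _ ?_)
  have e3 : (q : R) • (b * x - x * b) = w - ((q : R) - p) • (x * b) := by
    rw [e1, smul_smul, Units.mul_inv, one_smul]
  have e4 : (q : R) • (b * x - x * b) = ((q : R) - p) • (b * x) - w := by
    rw [e2, smul_smul, Units.mul_inv, one_smul]
  linear_combination (norm := module) e3 + e4

/-- Once `b` commutes with the triple commutator of `a, b, c`, the commutator of `[a, b]_p` and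
`[b, c]_p` is a multiple of the product of the two. -/
theorem commutator_of_commute_triple (h : QCommute (q : R) (qComm p a b) b)
    (hb : Commute b (qComm p (qComm p a b) c)) :
    qComm p a b * qComm p b c - qComm p b c * qComm p a b =
      ((q : R) - p) • (qComm p (qComm p a b) c * b) := by
  have e1 := commutator_qComm_right (c := c) h
  rw [hb.eq, sub_self] at e1
  have e2 := congrArg ((q : R) • ·) e1
  simp only [smul_smul, Units.mul_inv, one_smul, smul_zero] at e2
  exact (sub_eq_zero.mp e2.symm)

end TripleCommutator

namespace IsQuantumSerre

variable {q : Rˣ} {E : ℕ → A}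

local notation "p" => ((q⁻¹ : Rˣ) : R)

/-- The case `E_k` of `commute_of_nested`. The shortest instance, `E_{m+1}` against `e_{m,m+3}`, is
`commute_triple`; longer root vectors are split so that the outer factors are far from `E_k`. -/
theorem commute_gen_of_nested (hE : IsQuantumSerre q E)
    (h2 : ∀ y : A, ((q : R) + p) • y = 0 → y = 0) {i j k : ℕ} (hik : i < k) (hkj : k + 1 < j) :
    Commute (E k) (rootVec p E i j) := by
  have base : ∀ m, Commute (E (m + 1)) (rootVec p E m (m + 3)) := fun m => by
    have e1 : rootVec p E m (m + 2) = qComm p (E m) (E (m + 1)) := by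
      rw [rootVec_eq_qComm _ _ (by omega), rootVec_succ]
    have e2 : rootVec p E (m + 1) (m + 3) = qComm p (E (m + 1)) (E (m + 2)) := by
      rw [rootVec_eq_qComm _ _ (by omega), rootVec_succ]
    rw [hE.rootVec_split (by omega : m < m + 2) (by omega), rootVec_succ, e1]
    refine commute_triple h2 (hE.comm _ _ (by omega)) ?_ ?_
    · rw [← e1]; exact hE.rootVec_two_gen m
    · rw [← e2]; exact hE.gen_rootVec_two (m + 1)
  have left : Commute (E k) (rootVec p E i (k + 2)) := by
    obtain ⟨m, rfl⟩ : ∃ m, k = m + 1 := ⟨k - 1, by omega⟩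
    rcases (Nat.le_of_lt_succ hik).eq_or_lt with rfl | h
    · exact base i
    · rw [hE.rootVec_split h (by omega)]
      exact (hE.commute_of_far h (Or.inr (by omega))).qComm_right (base m)
  rcases (Nat.succ_le_of_lt hkj).eq_or_lt with rfl | h
  · exact left
  · rw [hE.rootVec_split (by omega : i < k + 2) h]
    exact left.qComm_right (hE.commute_of_far h (Or.inl (by omega)))

theorem commute_of_nested (hE : IsQuantumSerre q E)
    (h2 : ∀ y : A, ((q : R) + p) • y = 0 → y = 0) {i j u v : ℕ} (hiu : i < u) (huv : u < v)
    (hvj : v < j) : Commute (rootVec p E i j) (rootVec p E u v) :=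
  commute_rootVec huv fun _ hk hk' =>
    (hE.commute_gen_of_nested h2 (by omega) (by omega)).symm

theorem qCommute_of_row_eq (hE : IsQuantumSerre q E)
    (h2 : ∀ y : A, ((q : R) + p) • y = 0 → y = 0) {i j v : ℕ} (hij : i < j) (hjv : j < v) :
    QCommute (q : R) (rootVec p E i j) (rootVec p E i v) := by
  rcases (Nat.succ_le_of_lt hij).eq_or_lt with rfl | h
  · rw [rootVec_succ]
    exact hE.gen_rootVec hjv
  · rw [rootVec_eq_qComm _ _ h, ← mul_one (q : R)]
    exact (hE.gen_rootVec (by omega)).qComm_left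
      (hE.commute_of_nested h2 (by omega) h hjv).symm.qCommute

theorem qCommute_of_col_eq (hE : IsQuantumSerre q E)
    (h2 : ∀ y : A, ((q : R) + p) • y = 0 → y = 0) {i j u : ℕ} (hiu : i < u) (huj : u < j) :
    QCommute (q : R) (rootVec p E i j) (rootVec p E u j) := by
  obtain ⟨k, rfl⟩ : ∃ k, j = k + 1 := ⟨j - 1, by omega⟩
  rcases (Nat.le_of_lt_succ huj).eq_or_lt with rfl | h
  · rw [rootVec_succ]
    exact hE.rootVec_gen hiu
  · rw [hE.rootVec_split h (by omega : k < k + 1), rootVec_succ, ← one_mul (q : R)]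
    exact (hE.commute_of_nested h2 hiu h (by omega)).qCommute.qComm_right
      (hE.rootVec_gen (by omega))

theorem commutator_of_crossing (hE : IsQuantumSerre q E)
    (h2 : ∀ y : A, ((q : R) + p) • y = 0 → y = 0) {i j u v : ℕ} (hiu : i < u) (huj : u < j)
    (hjv : j < v) :
    rootVec p E i j * rootVec p E u v - rootVec p E u v * rootVec p E i j =
      ((q : R) - p) • (rootVec p E i v * rootVec p E u j) := by
  have e1 := hE.rootVec_split hiu huj
  have e2 := hE.rootVec_split huj hjv
  have e3 := hE.rootVec_split (by omega : i < j) hjv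
  rw [e3, e2, e1]
  refine commutator_of_commute_triple ?_ ?_
  · rw [← e1]
    exact hE.qCommute_of_col_eq h2 hiu huj
  · rw [← e1, ← e3]
    exact (hE.commute_of_nested h2 hiu huj hjv).symm

end IsQuantumSerre

end RootVectors

/-! ### Straightening -/

section Straightening

variable {R A ι : Type*} [CommRing R] [Ring A] [Algebra R A]

/-- The span of the words of degree less than `D` in the elements `e x`, where the letter `x` has
degree `η x`. -/
def lowWords (R : Type*) [CommRing R] [Algebra R A] (e : ι → A) (η : ι → ℕ) (D : ℕ) :
    Submodule R A :=
  Submodule.span R {a | ∃ l : List ι, (l.map η).sum < D ∧ a = (l.map e).prod}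

variable {e : ι → A} {η : ι → ℕ}

theorem prod_mem_lowWords {D : ℕ} (l : List ι) (h : (l.map η).sum < D) :
    (l.map e).prod ∈ lowWords R e η D :=
  Submodule.subset_span ⟨l, h, rfl⟩

theorem mul_mem_lowWords {D : ℕ} {a : A} (x : ι) (ha : a ∈ lowWords R e η D) :
    e x * a ∈ lowWords R e η (η x + D) := by
  induction ha using Submodule.span_induction with
  | mem a ha =>
    obtain ⟨l, hl, rfl⟩ := ha
    exact Submodule.subset_span ⟨x :: l, by simpa using hl, by simp⟩
  | zero => simp
  | add a b _ _ iha ihb => rw [mul_add]; exact add_mem iha ihb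
  | smul c a _ iha => rw [mul_smul_comm]; exact Submodule.smul_mem _ c iha

theorem mul_prod_mem_lowWords {D : ℕ} {a : A} (l : List ι) (ha : a ∈ lowWords R e η D) :
    a * (l.map e).prod ∈ lowWords R e η (D + (l.map η).sum) := by
  induction ha using Submodule.span_induction with
  | mem a ha =>
    obtain ⟨l', hl, rfl⟩ := ha
    exact Submodule.subset_span ⟨l' ++ l, by simpa using hl, by simp⟩
  | zero => simp
  | add a b _ _ iha ihb => rw [add_mul]; exact add_mem iha ihb
  | smul c a _ iha => rw [smul_mul_assoc]; exact Submodule.smul_mem _ c iha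

/-- If any two letters commute up to a unit and terms of lower degree, then so do the letters of any
word. -/
theorem prod_sub_smul_prod_mem_of_perm
    (h : ∀ x y : ι, ∃ c : Rˣ, e x * e y - (c : R) • (e y * e x) ∈ lowWords R e η (η x + η y))
    {l l' : List ι} (hl : l.Perm l') :
    ∃ c : Rˣ, (l.map e).prod - (c : R) • (l'.map e).prod ∈ lowWords R e η (l.map η).sum := by
  induction hl with
  | nil => exact ⟨1, by simp⟩
  | cons x _ ih =>
    obtain ⟨c, hc⟩ := ih
    refine ⟨c, ?_⟩
    have := mul_mem_lowWords x hc
    rwa [mul_sub, mul_smul_comm] at this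
  | swap x y l =>
    obtain ⟨c, hc⟩ := h y x
    refine ⟨c, ?_⟩
    have := mul_prod_mem_lowWords l hc
    rw [sub_mul, smul_mul_assoc] at this
    simpa [mul_assoc, add_assoc] using this
  | trans h1 h2 ih1 ih2 =>
    obtain ⟨c, hc⟩ := ih1
    obtain ⟨d, hd⟩ := ih2
    refine ⟨c * d, ?_⟩
    rw [← (h1.map η).sum_eq] at hd
    have := add_mem hc (Submodule.smul_mem _ (c : R) hd)
    rwa [smul_sub, smul_smul, sub_add_sub_cancel, ← Units.val_mul] at this

/-- Words whose letters commute up to units and terms of lower degree are combinations of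
non-decreasing words. -/
theorem prod_mem_span_sorted [LinearOrder ι]
    (h : ∀ x y : ι, ∃ c : Rˣ, e x * e y - (c : R) • (e y * e x) ∈ lowWords R e η (η x + η y))
    (l : List ι) :
    (l.map e).prod ∈ Submodule.span R
      (Set.range fun s : {s : List ι // s.Pairwise (· ≤ ·)} => (s.1.map e).prod) := by
  induction hD : (l.map η).sum using Nat.strong_induction_on generalizing l with
  | _ D ih =>
    obtain ⟨c, hc⟩ := prod_sub_smul_prod_mem_of_perm h (List.perm_insertionSort (· ≤ ·) l).symm
    have hlow : lowWords R e η (l.map η).sum ≤ Submodule.span R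
        (Set.range fun s : {s : List ι // s.Pairwise (· ≤ ·)} => (s.1.map e).prod) := by
      refine Submodule.span_le.mpr ?_
      rintro _ ⟨l', hl', rfl⟩
      exact ih _ (hD ▸ hl') l' rfl
    rw [← sub_add_cancel ((l.map e).prod) ((c : R) • ((l.insertionSort (· ≤ ·)).map e).prod)]
    exact add_mem (hlow hc) (Submodule.smul_mem _ _
      (Submodule.subset_span ⟨⟨_, List.pairwise_insertionSort (· ≤ ·) l⟩, rfl⟩))

/-- A subalgebra generated by letters is spanned by the non-decreasing words. -/
theorem adjoin_le_span_sorted [LinearOrder ι]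
    (h : ∀ x y : ι, ∃ c : Rˣ, e x * e y - (c : R) • (e y * e x) ∈ lowWords R e η (η x + η y))
    {s : Set A} (hs : s ⊆ Set.range e) :
    Subalgebra.toSubmodule (Algebra.adjoin R s) ≤ Submodule.span R
      (Set.range fun l : {l : List ι // l.Pairwise (· ≤ ·)} => (l.1.map e).prod) := by
  rw [Algebra.adjoin_eq_span]
  refine Submodule.span_le.mpr fun a ha => ?_
  suffices ∃ l : List ι, a = (l.map e).prod by
    obtain ⟨l, rfl⟩ := this
    exact prod_mem_span_sorted h l
  induction ha using Submonoid.closure_induction with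
  | mem a ha =>
    obtain ⟨x, rfl⟩ := hs ha
    exact ⟨[x], by simp⟩
  | one => exact ⟨[], by simp⟩
  | mul a b _ _ iha ihb =>
    obtain ⟨l, rfl⟩ := iha
    obtain ⟨l', rfl⟩ := ihb
    exact ⟨l ++ l', by simp⟩

end Straightening

section Spanning

variable {R A : Type*} [CommRing R] [Ring A] [Algebra R A] {n : ℕ}

/-- Extension by zero of a finite sequence of generators. -/
def extendZero (E : Fin n → A) (i : ℕ) : A := if h : i < n then E ⟨i, h⟩ else 0

theorem rootVector_eq (r : R) (E : Fin n → A) (x : PosRoot n) :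
    rootVector r E x = rootVec r (extendZero E) x.row x.col := rfl

namespace PosRoot

/-- The `i`-th simple root. -/
def simple (i : Fin n) : PosRoot n := ⟨(i.castSucc, i.succ), Fin.castSucc_lt_succ⟩

/-- The degree of `e_{ik}` is less than the sum of the degrees of `e_{ij}` and `e_{jk}`. -/
theorem deg_bracket_lt {x y z : PosRoot n} (h : x.col = y.row) (hr : z.row = x.row)
    (hc : z.col = y.col) : z.deg < x.deg + y.deg := by
  have h1 : (x.row : ℕ) < x.col := x.row_lt_col
  have h2 : (y.row : ℕ) < y.col := y.row_lt_col
  unfold deg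
  rw [hr, hc]
  rw [← h] at h2 ⊢
  obtain ⟨a, ha⟩ := Nat.exists_eq_add_of_lt h1
  obtain ⟨b, hb⟩ := Nat.exists_eq_add_of_lt h2
  rw [hb, ha]
  rw [show (x.row : ℕ) + a + 1 + b + 1 - x.row = a + b + 2 by omega,
    show (x.row : ℕ) + a + 1 - x.row = a + 1 by omega,
    show (x.row : ℕ) + a + 1 + b + 1 - (x.row + a + 1) = b + 1 by omega]
  nlinarith

/-- For `i < u < j < v` the degrees of `e_{iv}` and `e_{uj}` add up to less than those of `e_{ij}`
and `e_{uv}`. -/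
theorem deg_crossing_lt {x y z w : PosRoot n} (h1 : x.row < y.row) (h2 : y.row < x.col)
    (h3 : x.col < y.col) (hzr : z.row = x.row) (hzc : z.col = y.col) (hwr : w.row = y.row)
    (hwc : w.col = x.col) : z.deg + w.deg < x.deg + y.deg := by
  unfold deg
  rw [hzr, hzc, hwr, hwc]
  have h1' : (x.row : ℕ) < y.row := h1
  have h2' : (y.row : ℕ) < x.col := h2
  have h3' : (x.col : ℕ) < y.col := h3
  obtain ⟨a, ha⟩ := Nat.exists_eq_add_of_lt h1'
  obtain ⟨b, hb⟩ := Nat.exists_eq_add_of_lt h2'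
  obtain ⟨c, hc⟩ := Nat.exists_eq_add_of_lt h3'
  rw [hc, hb, ha]
  rw [show (x.row : ℕ) + a + 1 + b + 1 + c + 1 - x.row = a + b + c + 3 by omega,
    show (x.row : ℕ) + a + 1 + b + 1 - (x.row + a + 1) = b + 1 by omega,
    show (x.row : ℕ) + a + 1 + b + 1 - x.row = a + b + 2 by omega,
    show (x.row : ℕ) + a + 1 + b + 1 + c + 1 - (x.row + a + 1) = b + c + 2 by omega]
  nlinarith

end PosRoot

namespace IsQuantumSerre

variable {q : Rˣ} {E : Fin n → A}

local notation "p" => ((q⁻¹ : Rˣ) : R)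

/-- The commutation relations of the root vectors `e_{ij}` and `e_{uv}` with `(i, j)` before
`(u, v)` lexicographically. -/
theorem exists_straighten_of_lex (hE : IsQuantumSerre q (extendZero E))
    (h2 : ∀ y : A, ((q : R) + p) • y = 0 → y = 0) (x y : PosRoot n)
    (h : x.row < y.row ∨ x.row = y.row ∧ x.col < y.col) :
    ∃ c : Rˣ, rootVector p E x * rootVector p E y - (c : R) • (rootVector p E y * rootVector p E x)
      ∈ lowWords R (rootVector p E) PosRoot.deg (x.deg + y.deg) := by
  have hx : (x.row : ℕ) < x.col := x.row_lt_col
  have hy : (y.row : ℕ) < y.col := y.row_lt_col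
  have of_comm : Commute (rootVector p E x) (rootVector p E y) →
      ∃ c : Rˣ, rootVector p E x * rootVector p E y
        - (c : R) • (rootVector p E y * rootVector p E x)
        ∈ lowWords R (rootVector p E) PosRoot.deg (x.deg + y.deg) := fun hc =>
    ⟨1, by simp [hc.eq]⟩
  have of_qComm : QCommute (q : R) (rootVector p E x) (rootVector p E y) →
      ∃ c : Rˣ, rootVector p E x * rootVector p E y
        - (c : R) • (rootVector p E y * rootVector p E x)
        ∈ lowWords R (rootVector p E) PosRoot.deg (x.deg + y.deg) := fun hc =>
    ⟨q, by rw [hc, sub_self]; exact zero_mem _⟩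
  rcases h with h | ⟨h, h'⟩
  · have h' : (x.row : ℕ) < y.row := h
    rcases lt_trichotomy x.col y.row with hc | hc | hc
    · exact of_comm (hE.commute_rootVec_of_lt hx hc hy)
    · refine ⟨q⁻¹, ?_⟩
      let z : PosRoot n := ⟨(x.row, y.col), x.row_lt_col.trans (hc ▸ y.row_lt_col)⟩
      have e1 : rootVector p E z = qComm p (rootVector p E x) (rootVector p E y) := by
        have := hE.rootVec_split hx (hc ▸ hy : (x.col : ℕ) < y.col)
        rw [rootVector_eq, rootVector_eq, rootVector_eq, ← hc]
        exact this
      rw [qComm] at e1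
      rw [← e1]
      have hz : z.deg < x.deg + y.deg := PosRoot.deg_bracket_lt hc rfl rfl
      simpa using prod_mem_lowWords (R := R) (e := rootVector p E) [z] (by simpa using hz)
    · have hc' : (y.row : ℕ) < x.col := hc
      rcases lt_trichotomy x.col y.col with hd | hd | hd
      · refine ⟨1, ?_⟩
        let z : PosRoot n := ⟨(x.row, y.col), x.row_lt_col.trans hd⟩
        let w : PosRoot n := ⟨(y.row, x.col), hc⟩
        have hzw : z.deg + w.deg < x.deg + y.deg :=
          PosRoot.deg_crossing_lt h hc hd rfl rfl rfl rfl
        have e1 := hE.commutator_of_crossing h2 h' hc' hd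
        rw [Units.val_one, one_smul, rootVector_eq, rootVector_eq, e1]
        refine Submodule.smul_mem _ _ ?_
        change rootVector p E z * rootVector p E w ∈ _
        simpa using prod_mem_lowWords (R := R) (e := rootVector p E) [z, w] (by simpa using hzw)
      · refine of_qComm ?_
        have := hE.qCommute_of_col_eq h2 h' hy
        rw [rootVector_eq, rootVector_eq, hd]
        exact this
      · exact of_comm (hE.commute_of_nested h2 h' hy hd)
  · refine of_qComm ?_
    have := hE.qCommute_of_row_eq h2 hx h'
    rw [rootVector_eq, rootVector_eq, ← h]
    exact this

/-- Any two root vectors commute up to a unit and terms of lower degree. -/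
theorem exists_straighten (hE : IsQuantumSerre q (extendZero E))
    (h2 : ∀ y : A, ((q : R) + p) • y = 0 → y = 0) (x y : PosRoot n) :
    ∃ c : Rˣ, rootVector p E x * rootVector p E y - (c : R) • (rootVector p E y * rootVector p E x)
      ∈ lowWords R (rootVector p E) PosRoot.deg (x.deg + y.deg) := by
  by_cases h : x.row < y.row ∨ x.row = y.row ∧ x.col < y.col
  · exact hE.exists_straighten_of_lex h2 x y h
  by_cases h' : y.row < x.row ∨ y.row = x.row ∧ y.col < x.col
  · obtain ⟨c, hc⟩ := hE.exists_straighten_of_lex h2 y x h'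
    refine ⟨c⁻¹, ?_⟩
    rw [add_comm]
    have := Submodule.smul_mem _ (-((c⁻¹ : Rˣ) : R)) hc
    rwa [smul_sub, smul_smul, neg_mul, Units.inv_mul, neg_smul, neg_smul, one_smul,
      sub_neg_eq_add, neg_add_eq_sub] at this
  · have hr : x.row = y.row := by
      apply le_antisymm <;> by_contra! hlt <;> tauto
    have hc : x.col = y.col := by
      apply le_antisymm <;> by_contra! hlt
      · exact h' (Or.inr ⟨hr.symm, hlt⟩)
      · exact h (Or.inr ⟨hr, hlt⟩)
    obtain rfl : x = y := Subtype.ext (Prod.ext hr hc)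
    exact ⟨1, by simp⟩

/-- The ordered monomials in the root vectors span the subalgebra generated by the `E_i`. -/
theorem adjoin_le_span (hE : IsQuantumSerre q (extendZero E))
    (h2 : ∀ y : A, ((q : R) + p) • y = 0 → y = 0) :
    Subalgebra.toSubmodule (Algebra.adjoin R (Set.range E)) ≤ Submodule.span R
      (Set.range fun l : NondecSeq n => (l.1.map (rootVector p E)).prod) := by
  refine adjoin_le_span_sorted (hE.exists_straighten h2) ?_
  rintro _ ⟨i, rfl⟩
  refine ⟨PosRoot.simple i, ?_⟩
  change rootVec p (extendZero E) (i : ℕ) (i + 1) = E i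
  rw [rootVec_succ, extendZero, dif_pos i.2]

end IsQuantumSerre

end Spanning

/-! ### Quantum Serre relations from `q`-commuting variables -/

section Feigin

variable {R A : Type*} [CommRing R] [Ring A] [Algebra R A]

/-- The Cartan matrix of type `A`. -/
def cartanA (i k : ℕ) : ℤ := if i = k then 2 else if i + 1 = k ∨ k + 1 = i then -1 else 0

/-- A strict total order on the variables `(a, i)`: decreasing in the level `a`, then increasing in
the simple root `i`. -/
def Before (x y : ℕ × ℕ) : Prop := y.1 < x.1 ∨ x.1 = y.1 ∧ x.2 < y.2

instance : DecidableRel Before := fun x y =>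
  inferInstanceAs (Decidable (y.1 < x.1 ∨ x.1 = y.1 ∧ x.2 < y.2))

/-- The Cartan pairing of the two simple roots if `x` is before `y`, and `0` otherwise. -/
def halfForm (x y : ℕ × ℕ) : ℤ := if Before x y then cartanA x.2 y.2 else 0

/-- A family `X (a, i)` of variables, where `X x` and `X y` with `x` before `y` commute up to `q` to
the Cartan pairing of their simple roots. -/
def IsFeiginFamily (q : Rˣ) (X : ℕ × ℕ → A) : Prop :=
  ∀ x y, QCommute ((q ^ (halfForm x y - halfForm y x) : Rˣ) : R) (X x) (X y)

variable {q : Rˣ} {X : ℕ × ℕ → A}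

local notation "p" => ((q⁻¹ : Rˣ) : R)

theorem halfForm_far {a b i k : ℕ} (h : i + 1 < k) :
    halfForm (a, i) (b, k) - halfForm (b, k) (a, i) = 0 := by
  simp only [halfForm, cartanA]
  grind

theorem halfForm_adj {a b i k : ℕ} (h : i + 1 = k ∨ k + 1 = i) :
    halfForm (a, i) (b, k) - halfForm (b, k) (a, i) = if Before (a, i) (b, k) then -1 else 1 := by
  simp only [halfForm, cartanA, Before]
  grind

theorem halfForm_same {a b i : ℕ} (h : a < b) :
    halfForm (a, i) (b, i) - halfForm (b, i) (a, i) = -2 := by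
  simp only [halfForm, cartanA, Before]
  grind

/-- The trilinear form of the Serre relation, symmetrized in `x` and `x'`, vanishes on variables
that commute up to scalars satisfying one identity. -/
theorem serre_symmetrized {x x' y : A} {r s s' t : R} (h1 : QCommute t x x')
    (h2 : QCommute s x y) (h3 : QCommute s' x' y) (h : (1 + t) * (s * s' + 1) = r * (s * t + s')) :
    (x * x' * y - r • (x * y * x') + y * x * x') + (x' * x * y - r • (x' * y * x) + y * x' * x)
      = 0 := by
  unfold QCommute at *
  have e1 : x' * x * y = (s * s') • (y * (x' * x)) := by
    rw [mul_assoc, h2, mul_smul_comm, ← mul_assoc, h3, smul_mul_assoc, smul_smul, mul_assoc]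
  have e2 : x * x' * y = (t * (s * s')) • (y * (x' * x)) := by
    rw [h1, smul_mul_assoc, e1, smul_smul]
  have e3 : x * y * x' = (s * t) • (y * (x' * x)) := by
    rw [h2, smul_mul_assoc, mul_assoc, h1, mul_smul_comm, smul_smul]
  have e4 : x' * y * x = s' • (y * (x' * x)) := by
    rw [h3, smul_mul_assoc, mul_assoc]
  have e5 : y * x * x' = t • (y * (x' * x)) := by
    rw [mul_assoc, h1, mul_smul_comm]
  have e6 : y * x' * x = y * (x' * x) := mul_assoc _ _ _
  rw [e1, e2, e3, e4, e5, e6]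
  match_scalars
  linear_combination h

/-- The sum of the products `X (a₀, i) X (a₁, i + 1) ⋯ X (a_d, i + d)` over all chains of levels
`b = a₀ < a₁ < ⋯ < a_d < N`. -/
def chainSum (N : ℕ) (X : ℕ × ℕ → A) : ℕ → ℕ → ℕ → A
  | 0, i, b => X (b, i)
  | d + 1, i, b => X (b, i) * ∑ c ∈ Finset.range N with b < c, chainSum N X d (i + 1) c

namespace IsFeiginFamily

theorem commute (hX : IsFeiginFamily q X) {a b i k : ℕ} (h : i + 1 < k) :
    Commute (X (a, i)) (X (b, k)) := by
  have := hX (a, i) (b, k)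
  rw [halfForm_far h, zpow_zero, Units.val_one] at this
  exact this.commute

theorem qCommute_adj (hX : IsFeiginFamily q X) {a b i k : ℕ} (h : i + 1 = k ∨ k + 1 = i) :
    QCommute (if Before (a, i) (b, k) then p else (q : R)) (X (a, i)) (X (b, k)) := by
  have := hX (a, i) (b, k)
  rw [halfForm_adj h] at this
  split_ifs at this ⊢ <;> simpa using this

theorem qCommute_same (hX : IsFeiginFamily q X) {a b i : ℕ} (h : a < b) :
    QCommute (p * p) (X (a, i)) (X (b, i)) := by
  have := hX (a, i) (b, i)
  rw [halfForm_same h] at this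
  rwa [show (-2 : ℤ) = -1 + -1 by norm_num, zpow_add, zpow_neg_one, Units.val_mul] at this

/-- For levels `a < a'` the variable of level `a'` comes first, so `X (b, k)` cannot come after
`X (a, i)` and before `X (a', i)`; in each of the other three positions `serre_symmetrized`
applies. -/
theorem serre_pair (hX : IsFeiginFamily q X) {i k : ℕ} (h : i + 1 = k ∨ k + 1 = i) (a a' b : ℕ) :
    (X (a, i) * X (a', i) * X (b, k) - ((q : R) + p) • (X (a, i) * X (b, k) * X (a', i))
        + X (b, k) * X (a, i) * X (a', i))
      + (X (a', i) * X (a, i) * X (b, k) - ((q : R) + p) • (X (a', i) * X (b, k) * X (a, i))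
        + X (b, k) * X (a', i) * X (a, i)) = 0 := by
  have hq : p * (q : R) = 1 := Units.inv_mul q
  wlog haa : a ≤ a' generalizing a a'
  · rw [add_comm]
    exact this a' a (by omega)
  have h2 := hX.qCommute_adj (a := a) (b := b) h
  have h3 := hX.qCommute_adj (a := a') (b := b) h
  rcases haa.eq_or_lt with rfl | haa
  · refine serre_symmetrized ((Commute.refl _).qCommute) h2 h3 ?_
    split_ifs
    · linear_combination (-2) * hq
    · linear_combination (-2) * hq
  · refine serre_symmetrized (hX.qCommute_same haa) h2 h3 ?_
    split_ifs with h4 h5 h5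
    · linear_combination (-p * p - 1) * hq
    · simp only [Before] at h4 h5
      omega
    · linear_combination (-p * q - 1) * hq
    · linear_combination (-p * p - 1) * hq

/-- Feigin's map: the sums of the variables attached to each simple root satisfy the quantum Serre
relations. -/
theorem isQuantumSerre (hX : IsFeiginFamily q X) (h2 : ∀ z : A, z + z = 0 → z = 0) (N : ℕ) :
    IsQuantumSerre q fun i => ∑ a ∈ Finset.range N, X (a, i) where
  comm i k h := Commute.sum_right _ _ _ fun _ _ => Commute.sum_left _ _ _ fun _ _ => hX.commute h
  serre i k h := by
    -- a triple sum of terms that are antisymmetric in the first two indices vanishes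
    have key : ∀ f : ℕ → ℕ → ℕ → A, (∀ a a' b, f a a' b + f a' a b = 0) →
        ∑ a ∈ Finset.range N, ∑ a' ∈ Finset.range N, ∑ b ∈ Finset.range N, f a a' b = 0 := by
      intro f hf
      refine h2 _ ?_
      nth_rw 2 [Finset.sum_comm]
      simp only [← Finset.sum_add_distrib, hf, Finset.sum_const_zero]
    have expand : ∀ u v w : ℕ → A, (∑ a ∈ Finset.range N, u a) * (∑ b ∈ Finset.range N, v b) *
        (∑ c ∈ Finset.range N, w c) = ∑ a ∈ Finset.range N, ∑ b ∈ Finset.range N,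
          ∑ c ∈ Finset.range N, u a * v b * w c := fun u v w => by
      rw [Finset.sum_mul_sum, Finset.sum_mul]
      refine Finset.sum_congr rfl fun a _ => ?_
      rw [Finset.sum_mul]
      exact Finset.sum_congr rfl fun b _ => Finset.mul_sum _ _ _
    rw [← key _ (hX.serre_pair h), expand, expand, expand]
    simp only [Finset.sum_add_distrib, Finset.sum_sub_distrib, Finset.smul_sum]
    congr 1
    · congr 1
      exact Finset.sum_congr rfl fun a _ => Finset.sum_comm
    · rw [Finset.sum_comm]
      exact Finset.sum_congr rfl fun a _ => Finset.sum_comm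

theorem commute_chainSum (hX : IsFeiginFamily q X) (N : ℕ) {i k : ℕ} (h : i + 1 < k) (a d c : ℕ) :
    Commute (X (a, i)) (chainSum N X d k c) := by
  induction d generalizing k c with
  | zero => exact hX.commute h
  | succ d ih =>
    exact (hX.commute h).mul_right (Commute.sum_right _ _ _ fun c' _ => ih (by omega) c')

theorem qCommute_chainSum (hX : IsFeiginFamily q X) (N i b d c : ℕ) :
    QCommute (if b < c then (q : R) else p) (X (b, i)) (chainSum N X d (i + 1) c) := by
  have h : QCommute (if b < c then (q : R) else p) (X (b, i)) (X (c, i + 1)) := by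
    have h := hX.qCommute_adj (a := b) (b := c) (i := i) (Or.inl rfl)
    have e : Before (b, i) (c, i + 1) ↔ ¬ b < c := by
      simp only [Before]
      omega
    simp only [e, ite_not] at h
    exact h
  cases d with
  | zero => exact h
  | succ d =>
    have hc : Commute (X (b, i))
        (∑ c' ∈ Finset.range N with c < c', chainSum N X d (i + 1 + 1) c') :=
      Commute.sum_right _ _ _ fun c' _ => hX.commute_chainSum N (by omega) b d c'
    rw [chainSum, QCommute, ← mul_assoc, h, smul_mul_assoc, mul_assoc, hc.eq, mul_assoc]

/-- The `q⁻¹`-commutator with a new variable keeps the products whose levels increase and kills the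
others. -/
theorem qComm_chainSum (hX : IsFeiginFamily q X) (N i b d c : ℕ) :
    qComm p (X (b, i)) (chainSum N X d (i + 1) c) =
      if b < c then (1 - p * p) • (X (b, i) * chainSum N X d (i + 1) c) else 0 := by
  have h := hX.qCommute_chainSum N i b d c
  split_ifs at h ⊢ with hbc
  · have h' : chainSum N X d (i + 1) c * X (b, i) = p • (X (b, i) * chainSum N X d (i + 1) c) := by
      rw [h, smul_smul, Units.inv_mul, one_smul]
    rw [qComm, h', smul_smul, sub_smul, one_smul]
  · rw [qComm, h, sub_self]

/-- The image of a root vector under Feigin's map. -/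
theorem rootAux_eq_chainSum (hX : IsFeiginFamily q X) (N d i : ℕ) :
    rootAux p (fun i => ∑ a ∈ Finset.range N, X (a, i)) d i =
      (1 - p * p) ^ d • ∑ b ∈ Finset.range N, chainSum N X d i b := by
  induction d generalizing i with
  | zero => simp [rootAux, chainSum]
  | succ d ih =>
    have e : ∀ u v : ℕ → A, qComm p (∑ b ∈ Finset.range N, u b) (∑ c ∈ Finset.range N, v c) =
        ∑ b ∈ Finset.range N, ∑ c ∈ Finset.range N, qComm p (u b) (v c) := fun u v => by
      simp only [qComm, Finset.sum_sub_distrib, ← Finset.smul_sum]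
      rw [Finset.sum_mul_sum, Finset.sum_mul_sum,
        Finset.sum_comm (γ := ℕ) (f := fun i j => v i * u j)]
    have e' : ∀ (r : R) (u v : A), u * (r • v) - p • ((r • v) * u) = r • qComm p u v :=
      fun r u v => by rw [qComm, mul_smul_comm, smul_mul_assoc, smul_comm p r, ← smul_sub]
    rw [rootAux, ih, e', e, pow_succ, mul_smul]
    simp only [hX.qComm_chainSum, chainSum, Finset.mul_sum, Finset.smul_sum, Finset.sum_filter,
      smul_ite, smul_zero, mul_ite, mul_zero]

end IsFeiginFamily
end Feigin

/-! ### Linear independence of the ordered monomials -/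

section QuantumPolynomials

/-- The module of polynomials in the variables `(a, i)`, on which the `q`-commuting variables
operate. -/
abbrev QPoly (R : Type*) [CommRing R] : Type _ := (ℕ × ℕ →₀ ℕ) →₀ R

variable {R : Type*} [CommRing R] (q : Rˣ)

/-- The half form extended linearly to exponents. -/
def halfFormExp (x : ℕ × ℕ) (m : ℕ × ℕ →₀ ℕ) : ℤ := m.sum fun y k => (k : ℤ) * halfForm x y

theorem halfFormExp_add (x : ℕ × ℕ) (m m' : ℕ × ℕ →₀ ℕ) :
    halfFormExp x (m + m') = halfFormExp x m + halfFormExp x m' :=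
  Finsupp.sum_add_index' (by simp) (by intros; push_cast; ring)

theorem halfFormExp_single (x y : ℕ × ℕ) : halfFormExp x (Finsupp.single y 1) = halfForm x y := by
  rw [halfFormExp, Finsupp.sum_single_index] <;> simp

/-- Multiplication by the variable `x`, twisted by powers of `q`. -/
noncomputable def qVar (x : ℕ × ℕ) : Module.End R (QPoly R) :=
  Finsupp.linearCombination R fun m =>
    Finsupp.single (m + Finsupp.single x 1) ((q ^ halfFormExp x m : Rˣ) : R)

theorem qVar_single (x : ℕ × ℕ) (m : ℕ × ℕ →₀ ℕ) :
    qVar q x (Finsupp.single m 1) =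
      Finsupp.single (m + Finsupp.single x 1) ((q ^ halfFormExp x m : Rˣ) : R) := by
  rw [qVar, Finsupp.linearCombination_single, one_smul]

theorem isFeiginFamily_qVar : IsFeiginFamily q (qVar (R := R) q) := by
  intro x y
  refine Finsupp.lhom_ext' fun m => LinearMap.ext_ring ?_
  have h : ∀ (m : ℕ × ℕ →₀ ℕ) (c : R), Finsupp.single m c = c • Finsupp.single m (1 : R) :=
    fun m c => by simp
  simp only [LinearMap.comp_apply, Finsupp.lsingle_apply, LinearMap.smul_apply,
    Module.End.mul_apply]
  rw [qVar_single, qVar_single, h, map_smul, qVar_single, h (m + Finsupp.single x 1), map_smul,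
    qVar_single, add_right_comm m]
  simp only [Finsupp.smul_single, smul_eq_mul, ← Units.val_mul, ← zpow_add, halfFormExp_add,
    halfFormExp_single]
  congr 3
  ring

/-- The weight of an exponent: the variable `(a, i)` has weight `a`. -/
def expWeight (m : ℕ × ℕ →₀ ℕ) : ℕ := m.sum fun y k => k * y.1

theorem expWeight_add (m m' : ℕ × ℕ →₀ ℕ) : expWeight (m + m') = expWeight m + expWeight m' :=
  Finsupp.sum_add_index' (by simp) (by intros; ring)

theorem expWeight_single (y : ℕ × ℕ) : expWeight (Finsupp.single y 1) = y.1 := by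
  rw [expWeight, Finsupp.sum_single_index] <;> simp

/-- The polynomials whose monomials have weight at least `W`. -/
def weightGE (R : Type*) [CommRing R] (W : ℕ) : Submodule R (QPoly R) :=
  Finsupp.supported R R {m | W ≤ expWeight m}

theorem weightGE_anti {W W' : ℕ} (h : W ≤ W') : weightGE R W' ≤ weightGE R W :=
  Finsupp.supported_mono fun _ hm => h.trans hm

theorem single_mem_weightGE {W : ℕ} {m : ℕ × ℕ →₀ ℕ} (h : W ≤ expWeight m) (c : R) :
    Finsupp.single m c ∈ weightGE R W :=
  Finsupp.single_mem_supported R c h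

theorem qVar_mem_weightGE (x : ℕ × ℕ) {W : ℕ} {v : QPoly R} (hv : v ∈ weightGE R W) :
    qVar q x v ∈ weightGE R (x.1 + W) := by
  rw [qVar, Finsupp.linearCombination_apply]
  refine Submodule.sum_mem _ fun m hm => Submodule.smul_mem _ _ (single_mem_weightGE ?_ _)
  have hW : W ≤ expWeight m := hv hm
  rw [expWeight_add, expWeight_single]
  omega

/-- The part of lowest weight of `v` is a unit multiple of the monomial with exponent `m`. -/
def HasLowestTerm (v : QPoly R) (m : ℕ × ℕ →₀ ℕ) : Prop :=
  ∃ u : Rˣ, v - Finsupp.single m (u : R) ∈ weightGE R (expWeight m + 1)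

namespace HasLowestTerm

variable {q} {v w : QPoly R} {m : ℕ × ℕ →₀ ℕ}

theorem mem_weightGE (h : HasLowestTerm v m) : v ∈ weightGE R (expWeight m) := by
  obtain ⟨u, hu⟩ := h
  rw [← sub_add_cancel v (Finsupp.single m (u : R))]
  exact add_mem (weightGE_anti (Nat.le_succ _) hu) (single_mem_weightGE le_rfl _)

theorem add (h : HasLowestTerm v m) (hw : w ∈ weightGE R (expWeight m + 1)) :
    HasLowestTerm (v + w) m := by
  obtain ⟨u, hu⟩ := h
  refine ⟨u, ?_⟩
  rw [add_sub_right_comm]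
  exact add_mem hu hw

theorem smul (h : HasLowestTerm v m) (c : Rˣ) : HasLowestTerm ((c : R) • v) m := by
  obtain ⟨u, hu⟩ := h
  refine ⟨c * u, ?_⟩
  have := Submodule.smul_mem _ (c : R) hu
  rwa [smul_sub, Finsupp.smul_single, smul_eq_mul, ← Units.val_mul] at this

theorem qVar (h : HasLowestTerm v m) (x : ℕ × ℕ) :
    HasLowestTerm (qVar q x v) (Finsupp.single x 1 + m) := by
  obtain ⟨u, hu⟩ := h
  refine ⟨u * q ^ halfFormExp x m, ?_⟩
  have := qVar_mem_weightGE q x hu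
  rw [map_sub, show Finsupp.single m (u : R) = (u : R) • Finsupp.single m 1 by simp, map_smul,
    qVar_single, Finsupp.smul_single, smul_eq_mul, ← Units.val_mul, add_comm m] at this
  rwa [expWeight_add, expWeight_single, add_assoc]

end HasLowestTerm

/-- The exponent `(b, i) + (b + 1, i + 1) + ⋯ + (b + d, i + d)`. -/
noncomputable def chainExp : ℕ → ℕ → ℕ → (ℕ × ℕ →₀ ℕ)
  | 0, i, b => Finsupp.single (b, i) 1
  | d + 1, i, b => Finsupp.single (b, i) 1 + chainExp d (i + 1) (b + 1)

theorem expWeight_chainExp_mono (d i k : ℕ) {b c : ℕ} (h : b ≤ c) :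
    expWeight (chainExp d i b) ≤ expWeight (chainExp d k c) := by
  induction d generalizing i k b c with
  | zero => simpa [chainExp, expWeight_single]
  | succ d ih =>
    rw [chainExp, chainExp, expWeight_add, expWeight_add, expWeight_single, expWeight_single]
    exact add_le_add h (ih _ _ (by omega))

theorem expWeight_chainExp_strictMono (d i k : ℕ) {b c : ℕ} (h : b < c) :
    expWeight (chainExp d i b) + 1 ≤ expWeight (chainExp d k c) := by
  cases d with
  | zero => simpa [chainExp, expWeight_single]
  | succ d =>
    rw [chainExp, chainExp, expWeight_add, expWeight_add, expWeight_single, expWeight_single]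
    have := expWeight_chainExp_mono d (i + 1) (k + 1) (by omega : b + 1 ≤ c + 1)
    dsimp only
    omega

theorem chainSum_mem_weightGE (N d i b : ℕ) {W : ℕ} {v : QPoly R} (hv : v ∈ weightGE R W) :
    chainSum N (qVar q) d i b v ∈ weightGE R (expWeight (chainExp d i b) + W) := by
  induction d generalizing i b with
  | zero => simpa [chainSum, chainExp, expWeight_single] using qVar_mem_weightGE q (b, i) hv
  | succ d ih =>
    rw [chainSum, chainExp, Module.End.mul_apply, expWeight_add, expWeight_single, add_assoc]
    refine qVar_mem_weightGE q (b, i) ?_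
    rw [LinearMap.sum_apply]
    refine Submodule.sum_mem _ fun c hc => weightGE_anti ?_ (ih (i + 1) c)
    have := expWeight_chainExp_mono d (i + 1) (i + 1)
      (Nat.succ_le_of_lt (Finset.mem_filter.mp hc).2)
    simp only [Nat.succ_eq_add_one] at this
    omega

/-- In a sum of operators `chainSum` over a set of starting levels, the lowest term comes from the
least level. -/
theorem HasLowestTerm.sum_chainSum {N d i b : ℕ} {v : QPoly R} {m : ℕ × ℕ →₀ ℕ} {s : Finset ℕ}
    (hb : b ∈ s) (hs : ∀ c ∈ s, b ≤ c) (hv : v ∈ weightGE R (expWeight m))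
    (h : HasLowestTerm (chainSum N (_root_.qVar q) d i b v) (chainExp d i b + m)) :
    HasLowestTerm ((∑ c ∈ s, chainSum N (_root_.qVar q) d i c) v) (chainExp d i b + m) := by
  rw [← Finset.add_sum_erase s _ hb, LinearMap.add_apply, LinearMap.sum_apply]
  refine h.add (Submodule.sum_mem _ fun c hc => ?_)
  refine weightGE_anti ?_ (chainSum_mem_weightGE q N d i c hv)
  have h1 := Finset.mem_erase.mp hc
  have := expWeight_chainExp_strictMono d i i (lt_of_le_of_ne (hs c h1.2) (Ne.symm h1.1))
  rw [expWeight_add]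
  omega

theorem HasLowestTerm.chainSum {N d i b : ℕ} (hd : b + d < N) {v : QPoly R} {m : ℕ × ℕ →₀ ℕ}
    (hv : HasLowestTerm v m) :
    HasLowestTerm (chainSum N (_root_.qVar q) d i b v) (chainExp d i b + m) := by
  induction d generalizing i b with
  | zero => exact hv.qVar _
  | succ d ih =>
    rw [_root_.chainSum, chainExp, Module.End.mul_apply, add_assoc]
    refine HasLowestTerm.qVar ?_ _
    refine sum_chainSum q ?_ ?_ hv.mem_weightGE (ih (by omega))
    · simp only [Finset.mem_filter, Finset.mem_range]
      omega
    · intro c hc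
      exact (Finset.mem_filter.mp hc).2

/-- A root vector acts on lowest terms by adding the exponent of its own lowest chain, the one with
levels `0, 1, …, d`. -/
theorem HasLowestTerm.rootAux {N d i : ℕ} (hd : d < N)
    (hq : IsUnit (1 - ((q⁻¹ : Rˣ) : R) * ((q⁻¹ : Rˣ) : R))) {v : QPoly R} {m : ℕ × ℕ →₀ ℕ}
    (hv : HasLowestTerm v m) : HasLowestTerm
      (rootAux ((q⁻¹ : Rˣ) : R) (fun i => ∑ a ∈ Finset.range N, _root_.qVar q (a, i)) d i v)
      (chainExp d i 0 + m) := by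
  rw [(isFeiginFamily_qVar q).rootAux_eq_chainSum, LinearMap.smul_apply]
  obtain ⟨u, hu⟩ := hq
  rw [← hu, ← Units.val_pow_eq_pow_val]
  refine smul ?_ _
  refine sum_chainSum q (by simpa using by omega) (fun c _ => Nat.zero_le c) hv.mem_weightGE
    (hv.chainSum q (by omega))

/-- Polynomials whose parts of lowest weight are multiples of distinct monomials are linearly
independent. -/
theorem linearIndependent_of_hasLowestTerm {ι : Type*} {v : ι → QPoly R}
    {φ : ι → (ℕ × ℕ →₀ ℕ)} (hφ : Function.Injective φ) (h : ∀ i, HasLowestTerm (v i) (φ i)) :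
    LinearIndependent R v := by
  rw [linearIndependent_iff']
  intro s g hg
  suffices ∀ W, ∀ i ∈ s, expWeight (φ i) = W → g i = 0 from fun i hi => this _ i hi rfl
  intro W
  induction W using Nat.strong_induction_on with
  | _ W ih =>
    intro i hi hW
    have key := DFunLike.congr_fun hg (φ i)
    have coeff : ∀ (j : ι) (n : ℕ × ℕ →₀ ℕ), expWeight n ≤ expWeight (φ j) → n ≠ φ j →
        v j n = 0 := by
      intro j n hn hne
      obtain ⟨u, hu⟩ := h j
      have : (v j - Finsupp.single (φ j) (u : R)) n = 0 := by
        by_contra h0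
        have : expWeight (φ j) + 1 ≤ expWeight n := hu (Finsupp.mem_support_iff.mpr h0)
        omega
      rwa [Finsupp.sub_apply, Finsupp.single_eq_of_ne hne, sub_zero] at this
    have self : IsUnit (v i (φ i)) := by
      obtain ⟨u, hu⟩ := h i
      have : (v i - Finsupp.single (φ i) (u : R)) (φ i) = 0 := by
        by_contra h0
        have : expWeight (φ i) + 1 ≤ expWeight (φ i) := hu (Finsupp.mem_support_iff.mpr h0)
        omega
      rw [Finsupp.sub_apply, Finsupp.single_eq_same, sub_eq_zero] at this
      exact ⟨u, this.symm⟩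
    rw [Finsupp.finsetSum_apply, Finset.sum_eq_single_of_mem i hi] at key
    · rw [Finsupp.smul_apply, smul_eq_mul, Finsupp.zero_apply] at key
      exact (self.mul_left_eq_zero).mp key
    · intro j hj hji
      rw [Finsupp.smul_apply, smul_eq_mul]
      rcases Nat.lt_or_ge (expWeight (φ j)) W with hlt | hge
      · rw [ih _ hlt j hj rfl, zero_mul]
      · rw [coeff j (φ i) (by omega) fun e => hji (hφ e).symm, mul_zero]

end QuantumPolynomials

section RootExponents

variable {n : ℕ}

theorem chainExp_apply (d i b s k : ℕ) :
    chainExp d i b (s, k) = if b ≤ s ∧ s ≤ b + d ∧ i + s = k + b then 1 else 0 := by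
  induction d generalizing i b with
  | zero =>
    rw [chainExp, Finsupp.single_apply]
    refine if_congr ?_ rfl rfl
    rw [Prod.mk.injEq]
    omega
  | succ d ih =>
    rw [chainExp, Finsupp.add_apply, ih, Finsupp.single_apply]
    simp only [Prod.mk.injEq]
    split_ifs <;> omega

/-- The exponent of the lowest monomial in the image of the root vector `e_x`. -/
noncomputable def rootExp (x : PosRoot n) : ℕ × ℕ →₀ ℕ :=
  chainExp ((x.col : ℕ) - x.row - 1) x.row 0

theorem rootExp_apply (x : PosRoot n) (s k : ℕ) :
    rootExp x (s, k) = if (x.row : ℕ) + s = k ∧ k < x.col then 1 else 0 := by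
  have hx : (x.row : ℕ) < x.col := x.row_lt_col
  rw [rootExp, chainExp_apply]
  exact if_congr (by omega) rfl rfl

/-- The multiplicity of a root in a word can be read off from the exponent of the word: the
coefficient at `(j - i - 1, j - 1)` counts the roots `(i, v)` with `v ≥ j`. -/
theorem count_add_sum_rootExp (x : PosRoot n) (l : List (PosRoot n)) :
    l.count x + (l.map rootExp).sum ((x.col : ℕ) - x.row, (x.col : ℕ)) =
      (l.map rootExp).sum ((x.col : ℕ) - x.row - 1, (x.col : ℕ) - 1) := by
  induction l with
  | nil => simp
  | cons y l ih =>
    rw [List.count_cons, List.map_cons, List.sum_cons, Finsupp.add_apply, Finsupp.add_apply, ← ih,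
      rootExp_apply, rootExp_apply]
    have hx : (x.row : ℕ) < x.col := x.row_lt_col
    have hy : (y.row : ℕ) < y.col := y.row_lt_col
    have e : y = x ↔ (y.row : ℕ) = x.row ∧ (y.col : ℕ) = x.col := by
      rw [← Fin.ext_iff, ← Fin.ext_iff]
      exact ⟨fun h => h ▸ ⟨rfl, rfl⟩, fun h => Subtype.ext (Prod.ext h.1 h.2)⟩
    simp only [beq_iff_eq, e]
    split_ifs <;> omega

/-- A non-decreasing word is determined by its exponent. -/
theorem sum_rootExp_injective :
    Function.Injective fun l : NondecSeq n => (l.1.map rootExp).sum := by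
  intro l l' h
  have hp : l.1.Perm l'.1 := List.perm_iff_count.mpr fun x => by
    have h1 := count_add_sum_rootExp x l.1
    have h2 := count_add_sum_rootExp x l'.1
    simp only at h
    rw [h, ← h2] at h1
    exact Nat.add_right_cancel h1
  exact Subtype.ext (hp.eq_of_pairwise' l.2 l'.2)

end RootExponents

/-! ### The PBW bases -/

section RootVectorMaps

variable {R A B : Type*} [CommRing R] [Ring A] [Algebra R A] [Ring B] [Algebra R B]

theorem rootAux_congr (r : R) {E E' : ℕ → A} {d i : ℕ} (h : ∀ k, i ≤ k → k ≤ i + d → E k = E' k) :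
    rootAux r E d i = rootAux r E' d i := by
  induction d generalizing i with
  | zero => exact h i le_rfl le_rfl
  | succ d ih =>
    rw [rootAux, rootAux, h i le_rfl (by omega), ih fun k hk hk' => h k (by omega) (by omega)]

theorem map_rootAux (f : A →ₐ[R] B) (r : R) (E : ℕ → A) (d i : ℕ) :
    f (rootAux r E d i) = rootAux r (fun k => f (E k)) d i := by
  induction d generalizing i with
  | zero => rfl
  | succ d ih => rw [rootAux, rootAux, map_sub, map_smul, map_mul, map_mul, ih]

theorem map_rootVector {n : ℕ} (f : A →ₐ[R] B) (r : R) (E : Fin n → A) (x : PosRoot n) :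
    f (rootVector r E x) = rootVector r (fun k => f (E k)) x := by
  rw [rootVector, map_rootAux, rootVector]
  refine rootAux_congr r fun k _ _ => ?_
  split_ifs
  · rfl
  · exact map_zero f

/-- A root vector involves only the generators between its row and its column, so it does not depend
on how the finite sequence of generators is extended. -/
theorem rootVector_eq_rootAux {n : ℕ} (r : R) (E : ℕ → A) (x : PosRoot n) :
    rootVector r (fun k : Fin n => E k) x = rootAux r E ((x.col : ℕ) - x.row - 1) x.row := by
  refine rootAux_congr r fun k _ hk => dif_pos ?_
  have h1 : (x.row : ℕ) < x.col := x.row_lt_col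
  have h2 := x.col.is_lt
  omega

theorem isQuantumSerre_extendZero {n : ℕ} {q : Rˣ} {E : Fin n → A}
    (hc : ∀ i j : Fin n, (i : ℕ) + 1 < j → E i * E j = E j * E i)
    (hs : ∀ i j : Fin n, (i : ℕ) + 1 = j ∨ (j : ℕ) + 1 = i →
      E i * E i * E j - ((q : R) + ((q⁻¹ : Rˣ) : R)) • (E i * E j * E i) + E j * E i * E i = 0) :
    IsQuantumSerre q (extendZero E) where
  comm i j h := by
    unfold extendZero
    split_ifs with hi hj
    · exact hc ⟨i, hi⟩ ⟨j, hj⟩ h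
    · exact Commute.zero_right _
    · exact Commute.zero_left _
    · exact Commute.zero_left _
  serre i j h := by
    unfold extendZero
    split_ifs with hi hj
    · exact hs ⟨i, hi⟩ ⟨j, hj⟩ h
    · simp
    · simp
    · simp

end RootVectorMaps

section Specialization

variable (K : Type*) [Field K] [CharZero K]

theorem atZero_qUnit : atZero K (qUnit K) = 1 := by
  change PowerSeries.constantCoeff (R := K) (PowerSeries.exp K) = 1
  exact PowerSeries.constantCoeff_exp

theorem atZero_qUnit_inv : atZero K ((qUnit K)⁻¹ : (QRing K)ˣ) = 1 := by
  have h := map_mul (atZero K) (qUnit K : QRing K) ((qUnit K)⁻¹ : (QRing K)ˣ)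
  rw [Units.mul_inv, map_one, atZero_qUnit, one_mul] at h
  exact h.symm

theorem qUnit_add_inv_ne_zero : (qUnit K : QRing K) + ((qUnit K)⁻¹ : (QRing K)ˣ) ≠ 0 := by
  intro h
  have := congrArg (atZero K) h
  rw [map_add, atZero_qUnit, atZero_qUnit_inv, map_zero] at this
  norm_num at this

/-- If `q⁻² = 1` then `exp t = exp (-t)`, which fails in the coefficient of `t`. -/
theorem one_sub_qUnit_inv_sq_ne_zero :
    1 - (((qUnit K)⁻¹ : (QRing K)ˣ) : QRing K) * ((qUnit K)⁻¹ : (QRing K)ˣ) ≠ 0 := by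
  intro h
  have h1 : (qUnit K : QRing K) = ((qUnit K)⁻¹ : (QRing K)ˣ) := by
    have h2 := congrArg ((qUnit K : QRing K) * ·) h
    simp only [mul_sub, mul_one, mul_zero, ← mul_assoc, Units.mul_inv, one_mul] at h2
    exact sub_eq_zero.mp h2
  have h3 : PowerSeries.exp K = PowerSeries.evalNegHom (PowerSeries.exp K) :=
    congrArg Subtype.val h1
  have h4 := congrArg (PowerSeries.coeff (R := K) 1) h3
  rw [PowerSeries.evalNegHom, PowerSeries.coeff_rescale, PowerSeries.coeff_exp] at h4
  norm_num at h4

instance : CharZero (QField K) := by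
  have : CharZero (QRing K) :=
    charZero_of_injective_ringHom (f := algebraMap K (QRing K)) (RingHom.injective _)
  exact charZero_of_injective_ringHom (IsFractionRing.injective (QRing K) (QField K))

end Specialization

section PBW

variable (K : Type*) [Field K] [CharZero K] (n : ℕ)

theorem UqPlusField.isQuantumSerre :
    IsQuantumSerre (qUnitField K) (extendZero (UqPlusField.gen K n)) := by
  refine isQuantumSerre_extendZero (fun i j h => ?_) (fun i j h => ?_)
  · have := RingQuot.mkAlgHom_rel (QField K) (SerreRel.comm (q := qUnitField K) i j h)
    rwa [map_mul, map_mul] at this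
  · have := RingQuot.mkAlgHom_rel (QField K) (SerreRel.serre (q := qUnitField K) i j h)
    rwa [map_add, map_sub, map_smul, map_mul, map_mul, map_mul, map_mul, map_mul, map_mul,
      map_zero] at this

theorem qUnitField_add_inv_ne_zero :
    (qUnitField K : QField K) + ((qUnitField K)⁻¹ : (QField K)ˣ) ≠ 0 := by
  have : (qUnitField K : QField K) + ((qUnitField K)⁻¹ : (QField K)ˣ) =
      algebraMap (QRing K) (QField K) ((qUnit K : QRing K) + ((qUnit K)⁻¹ : (QRing K)ˣ)) := by
    rw [map_add]
    rfl
  rw [this]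
  exact (map_ne_zero_iff _ (IsFractionRing.injective (QRing K) (QField K))).mpr
    (qUnit_add_inv_ne_zero K)

theorem isUnit_one_sub_qUnitField_inv_sq :
    IsUnit (1 - (((qUnitField K)⁻¹ : (QField K)ˣ) : QField K) *
      ((qUnitField K)⁻¹ : (QField K)ˣ)) := by
  have : 1 - (((qUnitField K)⁻¹ : (QField K)ˣ) : QField K) * ((qUnitField K)⁻¹ : (QField K)ˣ) =
      algebraMap (QRing K) (QField K)
        (1 - (((qUnit K)⁻¹ : (QRing K)ˣ) : QRing K) * ((qUnit K)⁻¹ : (QRing K)ˣ)) := by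
    rw [map_sub, map_one, map_mul]
    rfl
  rw [this, isUnit_iff_ne_zero]
  exact (map_ne_zero_iff _ (IsFractionRing.injective (QRing K) (QField K))).mpr
    (one_sub_qUnit_inv_sq_ne_zero K)

/-- The representation of the quantum group on quantum polynomials, `E_i ↦ ∑ₐ X (a, i)`. -/
noncomputable def feiginRep :
    UqPlusField K n →ₐ[QField K] Module.End (QField K) (QPoly (QField K)) :=
  RingQuot.liftAlgHom (QField K) ⟨FreeAlgebra.lift (QField K) fun i : Fin n =>
      ∑ a ∈ Finset.range n, qVar (qUnitField K) (a, (i : ℕ)), by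
    have hE := (isFeiginFamily_qVar (qUnitField K)).isQuantumSerre
      (fun z h => by
        have h2 : (2 : QField K) • z = 0 := by rw [two_smul, h]
        exact (smul_eq_zero.mp h2).resolve_left two_ne_zero) n
    rintro _ _ (⟨i, j, h⟩ | ⟨i, j, h⟩)
    · simp only [map_mul, FreeAlgebra.lift_ι_apply]
      exact hE.comm _ _ h
    · simp only [map_add, map_sub, map_smul, map_mul, FreeAlgebra.lift_ι_apply, map_zero]
      exact hE.serre _ _ h⟩

theorem feiginRep_gen (i : Fin n) : feiginRep K n (UqPlusField.gen K n i) =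
    ∑ a ∈ Finset.range n, qVar (qUnitField K) (a, (i : ℕ)) := by
  refine (RingQuot.liftAlgHom_mkAlgHom_apply _ _ _ _).trans ?_
  rw [FreeAlgebra.lift_ι_apply]

theorem feiginRep_prod_hasLowestTerm (l : List (PosRoot n)) :
    HasLowestTerm (feiginRep K n (l.map (rootVector (((qUnitField K)⁻¹ : (QField K)ˣ) : QField K)
      (UqPlusField.gen K n))).prod (Finsupp.single 0 1)) (l.map rootExp).sum := by
  induction l with
  | nil => exact ⟨1, by simp⟩
  | cons x l ih =>
    rw [List.map_cons, List.prod_cons, map_mul, Module.End.mul_apply,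
      map_rootVector (B := Module.End (QField K) (QPoly (QField K))) (feiginRep K n) _
        (UqPlusField.gen K n) x]
    simp only [feiginRep_gen]
    rw [rootVector_eq_rootAux _ (fun k => ∑ a ∈ Finset.range n, qVar (qUnitField K) (a, k))]
    have h1 : (x.row : ℕ) < x.col := x.row_lt_col
    have h2 := x.col.is_lt
    exact ih.rootAux _ (by omega) (isUnit_one_sub_qUnitField_inv_sq K)

theorem UqPlusField.linearIndependent_monomials :
    LinearIndependent (QField K) fun l : NondecSeq n =>
      (l.1.map (rootVector (((qUnitField K)⁻¹ : (QField K)ˣ) : QField K)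
        (UqPlusField.gen K n))).prod :=
  LinearIndependent.of_comp
    ((LinearMap.applyₗ (Finsupp.single 0 1)).comp (feiginRep K n).toLinearMap)
    (linearIndependent_of_hasLowestTerm sum_rootExp_injective
      fun l => feiginRep_prod_hasLowestTerm K n l.1)

theorem UqPlusField.adjoin_gen :
    Algebra.adjoin (QField K) (Set.range (UqPlusField.gen K n)) = ⊤ := by
  have h := congrArg (Subalgebra.map (RingQuot.mkAlgHom (QField K) (SerreRel (qUnitField K) n)))
    (FreeAlgebra.adjoin_range_ι (R := QField K) (X := Fin n))
  rw [AlgHom.map_adjoin, ← Set.range_comp, Algebra.map_top,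
    (AlgHom.range_eq_top _).mpr (RingQuot.mkAlgHom_surjective _ _)] at h
  exact h

theorem UqPlusField.exists_basis :
    ∃ b : Module.Basis (NondecSeq n) (QField K) (UqPlusField K n), ∀ l : NondecSeq n,
      b l = (l.1.map (rootVector (((qUnitField K)⁻¹ : (QField K)ˣ) : QField K)
        (UqPlusField.gen K n))).prod := by
  refine ⟨Module.Basis.mk (UqPlusField.linearIndependent_monomials K n) ?_,
    fun l => Module.Basis.mk_apply _ _ l⟩
  refine le_trans ?_ ((UqPlusField.isQuantumSerre K n).adjoin_le_span fun y hy =>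
    (smul_eq_zero.mp hy).resolve_left (qUnitField_add_inv_ne_zero K))
  rw [UqPlusField.adjoin_gen, Algebra.top_toSubmodule]

/-- The inclusion of the `k`-form. -/
noncomputable def UqPlus.incl : UqPlus K n →ₐ[QRing K] UqPlusField K n := (uqPlusForm K n).val

theorem UqPlus.incl_injective : Function.Injective (UqPlus.incl K n) := Subtype.val_injective

theorem UqPlus.incl_gen (i : Fin n) : UqPlus.incl K n (UqPlus.gen K n i) = UqPlusField.gen K n i :=
  rfl

theorem UqPlusField.algebraMap_smul' (c : QRing K) (y : UqPlusField K n) :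
    c • y = algebraMap (QRing K) (QField K) c • y := (algebraMap_smul _ _ _).symm

theorem UqPlus.isQuantumSerre : IsQuantumSerre (qUnit K) (extendZero (UqPlus.gen K n)) := by
  have hE := UqPlusField.isQuantumSerre K n
  have gen_eq : ∀ i : Fin n, extendZero (UqPlusField.gen K n) i = UqPlusField.gen K n i :=
    fun i => dif_pos i.2
  refine isQuantumSerre_extendZero (fun i j h => UqPlus.incl_injective K n ?_)
    (fun i j h => UqPlus.incl_injective K n ?_)
  · rw [map_mul, map_mul, incl_gen, incl_gen]
    simpa only [gen_eq] using (hE.comm i j h).eq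
  · have := hE.serre i j h
    simp only [gen_eq] at this
    simp only [map_add, map_sub, map_smul, map_mul, map_zero, incl_gen]
    rw [UqPlusField.algebraMap_smul', map_add]
    exact this

theorem rootVector_restrictScalars (x : PosRoot n) :
    rootVector (((qUnit K)⁻¹ : (QRing K)ˣ) : QRing K) (UqPlusField.gen K n) x =
      rootVector (((qUnitField K)⁻¹ : (QField K)ˣ) : QField K) (UqPlusField.gen K n) x := by
  rw [rootVector, rootVector]
  generalize (x.col : ℕ) - x.row - 1 = d
  generalize (x.row : ℕ) = i
  induction d generalizing i with
  | zero => rfl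
  | succ d ih =>
    rw [rootAux, rootAux, ih, UqPlusField.algebraMap_smul']
    rfl

theorem UqPlus.incl_monomial (l : List (PosRoot n)) :
    UqPlus.incl K n (l.map (rootVector (((qUnit K)⁻¹ : (QRing K)ˣ) : QRing K)
      (UqPlus.gen K n))).prod =
      (l.map (rootVector (((qUnitField K)⁻¹ : (QField K)ˣ) : QField K)
        (UqPlusField.gen K n))).prod := by
  rw [map_list_prod, List.map_map]
  congr 1
  refine List.map_congr_left fun x _ => ?_
  rw [Function.comp_apply, map_rootVector, ← rootVector_restrictScalars]
  rfl

theorem UqPlus.linearIndependent_monomials :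
    LinearIndependent (QRing K) fun l : NondecSeq n =>
      (l.1.map (rootVector (((qUnit K)⁻¹ : (QRing K)ˣ) : QRing K) (UqPlus.gen K n))).prod := by
  refine LinearIndependent.of_comp (UqPlus.incl K n).toLinearMap ?_
  have h := (UqPlusField.linearIndependent_monomials K n).restrict_scalars (R := QRing K)
    (fun a b hab => IsFractionRing.injective (QRing K) (QField K)
      (by simpa [Algebra.smul_def] using hab))
  convert h using 1
  funext l
  exact UqPlus.incl_monomial K n l.1

theorem UqPlus.adjoin_gen :
    Algebra.adjoin (QRing K) (Set.range (UqPlus.gen K n)) = ⊤ := by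
  have h := Algebra.adjoin_adjoin_coe_preimage (R := QRing K)
    (s := Set.range (UqPlusField.gen K n))
  have e : Set.range (UqPlus.gen K n) = (Subtype.val : uqPlusForm K n → UqPlusField K n) ⁻¹'
      Set.range (UqPlusField.gen K n) := by
    ext y
    constructor
    · rintro ⟨i, rfl⟩
      exact ⟨i, rfl⟩
    · rintro ⟨i, hi⟩
      exact ⟨i, Subtype.ext hi⟩
  rw [e]
  exact h

theorem UqPlus.exists_basis :
    ∃ b : Module.Basis (NondecSeq n) (QRing K) (UqPlus K n), ∀ l : NondecSeq n,
      b l = (l.1.map (rootVector (((qUnit K)⁻¹ : (QRing K)ˣ) : QRing K)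
        (UqPlus.gen K n))).prod := by
  refine ⟨Module.Basis.mk (UqPlus.linearIndependent_monomials K n) ?_,
    fun l => Module.Basis.mk_apply _ _ l⟩
  refine le_trans ?_ ((UqPlus.isQuantumSerre K n).adjoin_le_span fun y hy => ?_)
  · rw [UqPlus.adjoin_gen, Algebra.top_toSubmodule]
  · refine UqPlus.incl_injective K n ?_
    have h := congrArg (UqPlus.incl K n) hy
    rw [map_smul, map_zero, UqPlusField.algebraMap_smul'] at h
    rw [map_zero]
    refine (smul_eq_zero.mp h).resolve_left ?_
    exact (map_ne_zero_iff _ (IsFractionRing.injective (QRing K) (QField K))).mpr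
      (qUnit_add_inv_ne_zero K)

end PBW

/-! ### Graded pieces spanned by basis elements -/

section Grading

theorem Module.Basis.isInternal_span_image {R ι M : Type*} [CommRing R] [AddCommGroup M]
    [Module R M] (b : Module.Basis ι R M) (η : ι → ℕ) :
    DirectSum.IsInternal fun d => Submodule.span R (b '' {x | η x = d}) := by
  rw [DirectSum.isInternal_submodule_iff_iSupIndep_and_iSup_eq_top]
  constructor
  · intro d
    simp only [← Submodule.span_iUnion, ← Set.image_iUnion]
    refine b.linearIndependent.disjoint_span_image ?_
    rw [Set.disjoint_left]
    intro x hx hx'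
    simp only [Set.mem_iUnion, Set.mem_ofPred_eq] at hx hx'
    obtain ⟨d', hd', h⟩ := hx'
    exact hd' (h.symm.trans hx)
  · rw [← Submodule.span_iUnion, ← Set.image_iUnion, ← b.span_eq, ← Set.image_univ]
    congr 2
    ext x
    simp

/-- A linear map on `L ⊗ L` sends tensors of elements of two spans into `N` if it does so
on tensors of generators. -/
theorem TensorProduct.map_tmul_mem {R ι L M : Type*} [CommRing R] [AddCommGroup L] [Module R L]
    [AddCommMonoid M] [Module R M] (f : L ⊗[R] L →ₗ[R] M)
    {b : ι → L} {s t : Set ι} {N : Submodule R M}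
    (h : ∀ x ∈ s, ∀ y ∈ t, f (b x ⊗ₜ[R] b y) ∈ N) {u v : L} (hu : u ∈ Submodule.span R (b '' s))
    (hv : v ∈ Submodule.span R (b '' t)) : f (u ⊗ₜ[R] v) ∈ N := by
  induction hu, hv using Submodule.span_induction₂ with
  | mem_mem u v hu hv =>
    obtain ⟨x, hx, rfl⟩ := hu
    obtain ⟨y, hy, rfl⟩ := hv
    exact h x hx y hy
  | zero_left v _ => simp
  | zero_right u _ => simp
  | add_left u u' v _ _ _ h1 h2 => rw [TensorProduct.add_tmul, map_add]; exact add_mem h1 h2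
  | add_right u v v' _ _ _ h1 h2 => rw [TensorProduct.tmul_add, map_add]; exact add_mem h1 h2
  | smul_left c u v _ _ h1 =>
    rw [← TensorProduct.smul_tmul', map_smul]; exact N.smul_mem c h1
  | smul_right c u v _ _ h1 =>
    rw [TensorProduct.tmul_smul, map_smul]; exact N.smul_mem c h1

end Grading

namespace TLieData

variable {R ι L : Type*} [CommRing R] [LinearOrder ι] [AddCommGroup L] [Module R L]
  (D : TLieData R ι L)

theorem S12_tmul (x y z : L) : D.S12 (x ⊗ₜ[R] (y ⊗ₜ[R] z)) =
    TensorProduct.assoc R L L L (D.S (x ⊗ₜ[R] y) ⊗ₜ[R] z) := rfl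

theorem S23_tmul (x : L) (v : L ⊗[R] L) : D.S23 (x ⊗ₜ[R] v) = x ⊗ₜ[R] D.S v := rfl

theorem brId_tmul (x y z : L) : D.brId (x ⊗ₜ[R] (y ⊗ₜ[R] z)) = D.br (x ⊗ₜ[R] y) ⊗ₜ[R] z := rfl

theorem idBr_tmul (x : L) (v : L ⊗[R] L) : D.idBr (x ⊗ₜ[R] v) = x ⊗ₜ[R] D.br v := rfl

variable {D}

theorem mem_filtLT {m : ℕ} {d : ℕ} (h : d < m) {a : L} (ha : a ∈ D.gr d) : a ∈ D.filtLT m :=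
  Submodule.mem_iSup_of_mem (⟨d, h⟩ : {d : ℕ // d < m}) ha

theorem tmul_mem_filtLT₂ {m c d : ℕ} (h : c + d < m) {a b : L} (ha : a ∈ D.gr c)
    (hb : b ∈ D.gr d) : a ⊗ₜ[R] b ∈ D.filtLT₂ m :=
  Submodule.mem_iSup_of_mem (⟨(c, d), h⟩ : {p : ℕ × ℕ // p.1 + p.2 < m})
    ⟨(⟨a, ha⟩ : D.gr c) ⊗ₜ[R] (⟨b, hb⟩ : D.gr d), rfl⟩

theorem mult_left_of_basis (h : ∀ x y z : ι, x < y → y < z →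
    D.S (D.basis x ⊗ₜ[R] D.br (D.basis y ⊗ₜ[R] D.basis z)) =
      D.brId (D.S23 (D.S12 (D.basis x ⊗ₜ[R] (D.basis y ⊗ₜ[R] D.basis z))))) :
    ∀ v ∈ D.incr3, D.S (D.idBr v) = D.brId (D.S23 (D.S12 v)) := by
  intro v hv
  refine LinearMap.eqOn_span (f := D.S ∘ₗ D.idBr) (g := D.brId ∘ₗ D.S23 ∘ₗ D.S12) ?_ hv
  rintro _ ⟨x, y, z, hxy, hyz, rfl⟩
  exact h x y z hxy hyz

theorem mult_right_of_basis (h : ∀ x y z : ι, x < y → y < z →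
    D.S (D.br (D.basis x ⊗ₜ[R] D.basis y) ⊗ₜ[R] D.basis z) =
      D.idBr (D.S12 (D.S23 (D.basis x ⊗ₜ[R] (D.basis y ⊗ₜ[R] D.basis z))))) :
    ∀ v ∈ D.incr3, D.S (D.brId v) = D.idBr (D.S12 (D.S23 v)) := by
  intro v hv
  refine LinearMap.eqOn_span (f := D.S ∘ₗ D.brId) (g := D.idBr ∘ₗ D.S12 ∘ₗ D.S23) ?_ hv
  rintro _ ⟨x, y, z, hxy, hyz, rfl⟩
  exact h x y z hxy hyz

theorem jacobi_of_basis (h : ∀ x y z : ι, y < x → z < y →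
    D.br (D.idBr (D.S12 (D.S23 (D.basis x ⊗ₜ[R] (D.basis y ⊗ₜ[R] D.basis z)))))
      - D.br (D.brId (D.S23 (D.S12 (D.basis x ⊗ₜ[R] (D.basis y ⊗ₜ[R] D.basis z)))))
      + D.br (D.idBr (D.S23 (D.S12 (D.basis x ⊗ₜ[R] (D.basis y ⊗ₜ[R] D.basis z))))) = 0) :
    ∀ v ∈ D.decr3, D.br (D.idBr (D.S12 (D.S23 v)) - D.brId (D.S23 (D.S12 v)) +
      D.idBr (D.S23 (D.S12 v))) = 0 := by
  intro v hv
  refine LinearMap.eqOn_span (g := 0) (f := D.br ∘ₗ (D.idBr ∘ₗ D.S12 ∘ₗ D.S23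
    - D.brId ∘ₗ D.S23 ∘ₗ D.S12 + D.idBr ∘ₗ D.S23 ∘ₗ D.S12)) ?_ hv
  rintro _ ⟨x, y, z, hxy, hyz, rfl⟩
  have := h x y z hxy hyz
  rwa [← map_sub, ← map_add] at this

variable (D) in
theorem ext_basis {M : Type*} [AddCommMonoid M] [Module R M] {f g : L ⊗[R] L →ₗ[R] M}
    (h : ∀ x y : ι, f (D.basis x ⊗ₜ[R] D.basis y) = g (D.basis x ⊗ₜ[R] D.basis y)) : f = g :=
  (D.basis.tensorProduct D.basis).ext fun p => by
    rw [Module.Basis.tensorProduct_apply]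
    exact h p.1 p.2

theorem S_sq_of_basis {c : ι → ι → R}
    (hS : ∀ x y, D.S (D.basis x ⊗ₜ[R] D.basis y) = c x y • (D.basis y ⊗ₜ[R] D.basis x))
    (hc : ∀ x y, c x y * c y x = 1) : D.S ∘ₗ D.S = LinearMap.id :=
  D.ext_basis fun x y => by
    rw [LinearMap.comp_apply, hS, map_smul, hS, smul_smul, hc, one_smul, LinearMap.id_apply]

theorem br_S_of_basis {c : ι → ι → R}
    (hS : ∀ x y, D.S (D.basis x ⊗ₜ[R] D.basis y) = c x y • (D.basis y ⊗ₜ[R] D.basis x))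
    (h : ∀ x y, c x y • D.br (D.basis y ⊗ₜ[R] D.basis x) =
    -D.br (D.basis x ⊗ₜ[R] D.basis y)) : D.br ∘ₗ D.S = -D.br :=
  D.ext_basis fun x y => by
    rw [LinearMap.comp_apply, hS, map_smul, h, LinearMap.neg_apply]

theorem pb_S_of_basis {c : ι → ι → R}
    (hS : ∀ x y, D.S (D.basis x ⊗ₜ[R] D.basis y) = c x y • (D.basis y ⊗ₜ[R] D.basis x))
    (h : ∀ x y, c x y • D.pb (D.basis y ⊗ₜ[R] D.basis x) +
    D.pb (D.basis x ⊗ₜ[R] D.basis y) = 0) : D.pb ∘ₗ D.S = -D.pb :=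
  D.ext_basis fun x y => by
    rw [LinearMap.comp_apply, hS, map_smul, LinearMap.neg_apply, eq_neg_iff_add_eq_zero, h]

/-- If the iterated brackets of `z < y < x` with the arguments in increasing order agree and
`[y, [z, x]]` vanishes, the Jacobi identity holds: its first two terms carry the same product of
scalars with opposite signs. -/
theorem jacobi_of_assoc {c : ι → ι → R}
    (hS : ∀ x y, D.S (D.basis x ⊗ₜ[R] D.basis y) = c x y • (D.basis y ⊗ₜ[R] D.basis x))
    (hbr : ∀ x y, c x y • D.br (D.basis y ⊗ₜ[R] D.basis x) =
      -D.br (D.basis x ⊗ₜ[R] D.basis y))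
    (h : ∀ x y z, y < x → z < y → D.br (D.br (D.basis z ⊗ₜ[R] D.basis y) ⊗ₜ[R] D.basis x) =
      D.br (D.basis z ⊗ₜ[R] D.br (D.basis y ⊗ₜ[R] D.basis x)))
    (h' : ∀ x y z, y < x → z < y →
      D.br (D.basis y ⊗ₜ[R] D.br (D.basis z ⊗ₜ[R] D.basis x)) = 0) :
    ∀ v ∈ D.decr3, D.br (D.idBr (D.S12 (D.S23 v)) - D.brId (D.S23 (D.S12 v)) +
      D.idBr (D.S23 (D.S12 v))) = 0 := by
  refine jacobi_of_basis fun x y z hyx hzy => ?_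
  have hbr' : ∀ x y, D.br (D.basis x ⊗ₜ[R] D.basis y) =
      -(c x y • D.br (D.basis y ⊗ₜ[R] D.basis x)) := fun x y => by rw [hbr, neg_neg]
  have t1 : D.S12 (D.S23 (D.basis x ⊗ₜ[R] (D.basis y ⊗ₜ[R] D.basis z))) = (c y z * c x z) •
      (D.basis z ⊗ₜ[R] (D.basis x ⊗ₜ[R] D.basis y)) := by
    rw [S23_tmul, hS, TensorProduct.tmul_smul, map_smul, S12_tmul, hS,
      ← TensorProduct.smul_tmul', map_smul, TensorProduct.assoc_tmul, smul_smul]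
  have t2 : D.S23 (D.S12 (D.basis x ⊗ₜ[R] (D.basis y ⊗ₜ[R] D.basis z))) = (c x y * c x z) •
      (D.basis y ⊗ₜ[R] (D.basis z ⊗ₜ[R] D.basis x)) := by
    rw [S12_tmul, hS, ← TensorProduct.smul_tmul', map_smul, map_smul,
      TensorProduct.assoc_tmul, S23_tmul, hS, TensorProduct.tmul_smul, smul_smul]
  rw [t1, t2]
  simp only [map_smul, idBr_tmul, brId_tmul]
  rw [h' x y z hyx hzy, hbr' x y, hbr' y z, TensorProduct.tmul_neg, TensorProduct.neg_tmul,
    TensorProduct.tmul_smul, ← TensorProduct.smul_tmul', map_neg, map_neg, map_smul, map_smul,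
    h x y z hyx hzy]
  module

theorem br_T_of_br_S (hT : D.T = D.S + D.pb) (h : D.br ∘ₗ D.S = -D.br) (h' : D.br ∘ₗ D.pb = 0) :
    D.br ∘ₗ D.T = -D.br := by
  rw [hT, LinearMap.comp_add, h, h', add_zero]

/-- The inverse of an isomorphism of the data of `T`-Lie algebras is a morphism. -/
theorem IsMorphism.symm {ι' L' : Type*} [LinearOrder ι'] [AddCommGroup L'] [Module R L']
    {D' : TLieData R ι' L'} {f : L ≃ₗ[R] L'} (h : IsMorphism D D' f.toLinearMap)
    (hgr : ∀ d, D'.gr d ≤ (D.gr d).map f.toLinearMap) : IsMorphism D' D f.symm.toLinearMap := by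
  have e1 : ∀ v, TensorProduct.map f.toLinearMap f.toLinearMap
      (TensorProduct.map f.symm.toLinearMap f.symm.toLinearMap v) = v :=
    fun v => (TensorProduct.congr f f).apply_symm_apply v
  have e2 : ∀ v, TensorProduct.map f.symm.toLinearMap f.symm.toLinearMap
      (TensorProduct.map f.toLinearMap f.toLinearMap v) = v :=
    fun v => (TensorProduct.congr f f).symm_apply_apply v
  refine ⟨fun d => ?_, ?_, ?_, ?_⟩
  · rintro _ ⟨v, hv, rfl⟩
    obtain ⟨w, hw, rfl⟩ := hgr d hv
    simpa using hw
  · refine LinearMap.ext fun v => ?_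
    have := LinearMap.congr_fun h.map_br (TensorProduct.map f.symm.toLinearMap f.symm.toLinearMap v)
    simp only [LinearMap.comp_apply, e1, LinearEquiv.coe_coe] at this ⊢
    rw [← this, LinearEquiv.symm_apply_apply]
  · refine LinearMap.ext fun v => ?_
    have := LinearMap.congr_fun h.map_pb (TensorProduct.map f.symm.toLinearMap f.symm.toLinearMap v)
    simp only [LinearMap.comp_apply, e1] at this ⊢
    rw [← this, e2]
  · refine LinearMap.ext fun v => ?_
    have := LinearMap.congr_fun h.map_S (TensorProduct.map f.symm.toLinearMap f.symm.toLinearMap v)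
    simp only [LinearMap.comp_apply, e1] at this ⊢
    rw [← this, e2]

end TLieData

/-! ### Classical Lie algebras as `T`-Lie algebras -/

section Classical

open TLieData

/-- A Lie algebra with an ordered basis is a `T`-Lie algebra as soon as the bracket lowers the
degree. -/
theorem classical_isTLie {R ι 𝔤 : Type*} [CommRing R] [LinearOrder ι] [LieRing 𝔤] [LieAlgebra R 𝔤]
    (b : Module.Basis ι R 𝔤) (η : ι → ℕ)
    (h : ∀ x y, ⁅b x, b y⁆ ∈ (classical b η).filtLT (η x + η y)) : (classical b η).IsTLie where
  S_sq := by
    refine TensorProduct.ext' fun x y => ?_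
    simp [classical]
  S_basis x y := ⟨1, by simp [classical]⟩
  mult_left := mult_left_of_basis fun x y z _ _ => rfl
  mult_right := mult_right_of_basis fun x y z _ _ => rfl
  grading := b.isInternal_span_image η
  br_stable c d u hu v hv := by
    refine TensorProduct.map_tmul_mem (classical b η).br (b := b) ?_ hu hv
    rintro x rfl y rfl
    exact h x y
  pb_stable c d u hu v hv := zero_mem _
  T_eq := (add_zero _).symm
  br_T := by
    refine TensorProduct.ext' fun x y => ?_
    change ⁅y, x⁆ = -⁅x, y⁆
    exact (lie_skew y x).symm
  pb_S := by simp [classical]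
  br_pb := by simp [classical]
  jacobi := jacobi_of_basis fun x y z _ _ => by
    change ⁅b z, ⁅b x, b y⁆⁆ - ⁅⁅b y, b z⁆, b x⁆ + ⁅b y, ⁅b z, b x⁆⁆ = 0
    have := lie_jacobi (b x) (b y) (b z)
    rw [← lie_skew (b x) ⁅b y, b z⁆] at this
    rw [← this]
    abel

end Classical

/-! ### The `T`-Lie algebra `(sl_{n+1}^+)_q` -/

namespace PosRoot

variable {n : ℕ}

theorem lt_iff {x y : PosRoot n} : x < y ↔ (x.row : ℕ) + x.col < y.row + y.col ∨
    (x.row : ℕ) + x.col = y.row + y.col ∧ (x.col : ℕ) < y.col :=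
  Prod.Lex.lt_iff

variable {R : Type*} [CommRing R]

/-- The positive root `(i, j)`. -/
def ofLt {i j : Fin (n + 1)} (h : i < j) : PosRoot n := ⟨(i, j), h⟩

theorem unit_of_lt {i j : Fin (n + 1)} (h : i < j) :
    unit R i j = Finsupp.single (ofLt h) 1 :=
  dif_pos h

theorem unit_of_row_col (z : PosRoot n) : unit R z.row z.col = Finsupp.single z 1 :=
  dif_pos z.2

/-- The root `x + y`, when the column of `x` is the row of `y`. -/
def join (x y : PosRoot n) (h : x.col = y.row) : PosRoot n :=
  ⟨(x.row, y.col), x.row_lt_col.trans (h ▸ y.row_lt_col)⟩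

/-- With `join_lt`, convexity of the order: the sum of two roots lies between them. -/
theorem lt_join {x y : PosRoot n} (h : x.col = y.row) : x < x.join y h := by
  have h1 : (y.row : ℕ) < y.col := y.row_lt_col
  have h2 : (x.col : ℕ) = y.row := congrArg _ h
  refine lt_iff.mpr (Or.inl ?_)
  change (x.row : ℕ) + x.col < x.row + y.col
  omega

theorem join_lt {x y : PosRoot n} (h : x.col = y.row) : x.join y h < y := by
  have h1 : (x.row : ℕ) < x.col := x.row_lt_col
  have h2 : (x.col : ℕ) = y.row := congrArg _ h
  refine lt_iff.mpr (Or.inl ?_)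
  change (x.row : ℕ) + y.col < y.row + y.col
  omega

theorem col_ne_row_of_lt {x y : PosRoot n} (h : x < y) : y.col ≠ x.row := by
  intro e
  have h1 : (x.row : ℕ) < x.col := x.row_lt_col
  have h2 : (y.row : ℕ) < y.col := y.row_lt_col
  have h3 : (y.col : ℕ) = x.row := congrArg _ e
  have := lt_iff.mp h
  omega

theorem usualBr_of_lt {x y : PosRoot n} (h : x < y) :
    usualBr R x y = if e : x.col = y.row then Finsupp.single (x.join y e) 1 else 0 := by
  rw [usualBr, if_neg (col_ne_row_of_lt h), sub_zero]
  split_ifs with e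
  · exact unit_of_row_col (x.join y e)
  · rfl

theorem usualBr_eq_zero {x y : PosRoot n} (h : x.col ≠ y.row) (h' : y.col ≠ x.row) :
    usualBr R x y = 0 := by
  rw [usualBr, if_neg h, if_neg h', sub_zero]

variable (q : Rˣ)

theorem qcoef_of_lt {x y : PosRoot n} (h : x < y) : qcoef q x y = ((q ^ cartan x y : Rˣ) : R) :=
  if_pos h

theorem qcoef_mul_qcoef (x y : PosRoot n) : qcoef q x y * qcoef q y x = 1 := by
  rcases lt_trichotomy x y with h | rfl | h
  · rw [qcoef, qcoef, if_pos h, if_neg h.not_gt, if_pos h, ← Units.val_mul, ← zpow_add]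
    simp
  · simp [qcoef]
  · rw [qcoef, qcoef, if_pos h, if_neg h.not_gt, if_pos h, ← Units.val_mul, ← zpow_add]
    simp

theorem cartan_join_right {x y z : PosRoot n} (h : y.col = z.row) :
    cartan x (y.join z h) = cartan x y + cartan x z := by
  simp only [cartan, h, show (y.join z h).row = y.row from rfl,
    show (y.join z h).col = z.col from rfl]
  ring

theorem cartan_join_left {x y z : PosRoot n} (h : x.col = y.row) :
    cartan (x.join y h) z = cartan x z + cartan y z := by
  simp only [cartan, h, show (x.join y h).row = x.row from rfl,
    show (x.join y h).col = y.col from rfl]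
  ring

theorem qBr_of_lt {x y : PosRoot n} (h : x < y) : qBr q x y = usualBr R x y := if_pos h

theorem qBr_of_gt {x y : PosRoot n} (h : y < x) :
    qBr q x y = -(qcoef q x y • usualBr R y x) := by
  rw [qBr, if_neg h.not_gt, if_pos h]

theorem qBr_self (x : PosRoot n) : qBr q x x = 0 := by simp [qBr]

theorem qBr_eq_zero {x y : PosRoot n} (h : x.col ≠ y.row) (h' : y.col ≠ x.row) :
    qBr q x y = 0 := by
  rw [qBr, usualBr_eq_zero h h', usualBr_eq_zero h' h]
  simp

theorem qcoef_smul_qBr (x y : PosRoot n) : qcoef q x y • qBr q y x = -qBr q x y := by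
  rcases lt_trichotomy x y with h | rfl | h
  · rw [qBr_of_lt q h, qBr_of_gt q h, smul_neg, smul_smul, qcoef_mul_qcoef, one_smul]
  · simp [qBr_self]
  · rw [qBr_of_lt q h, qBr_of_gt q h, neg_neg]

theorem qcoef_of_crossing {x y : PosRoot n} (h1 : x.row < y.row) (h2 : y.row < x.col)
    (h3 : x.col < y.col) : qcoef q x y = 1 ∧ qcoef q y x = 1 := by
  have hxy : x < y := lt_iff.mpr (Or.inl (by omega))
  have hc : cartan x y = 0 := by
    rw [cartan, if_neg (by omega), if_neg (by omega), if_neg (by omega), if_neg (by omega)]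
    rfl
  rw [qcoef, qcoef, if_pos hxy, if_neg hxy.not_gt, if_pos hxy, hc]
  simp

theorem qcoef_smul_qPb (x y : PosRoot n) : qcoef q x y • qPb q y x + qPb q x y = 0 := by
  by_cases h : x.row < y.row ∧ y.row < x.col ∧ x.col < y.col
  · have h' : ¬(y.row < x.row ∧ x.row < y.col ∧ y.col < x.col) := fun h' => by omega
    rw [(qcoef_of_crossing q h.1 h.2.1 h.2.2).1, one_smul, qPb, qPb, if_pos h, if_pos h, if_neg h',
      ← add_smul, sub_add_sub_cancel, sub_self, zero_smul]
  · by_cases h' : y.row < x.row ∧ x.row < y.col ∧ y.col < x.col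
    · rw [(qcoef_of_crossing q h'.1 h'.2.1 h'.2.2).2, one_smul, qPb, qPb, if_pos h', if_pos h',
        if_neg h, ← add_smul, sub_add_sub_cancel, sub_self, zero_smul]
    · rw [qPb, qPb, if_neg h, if_neg h', if_neg h, if_neg h', smul_zero, add_zero]

end PosRoot

section SlPlusQ

open TLieData PosRoot

variable {R : Type*} [CommRing R] (q : Rˣ) (n : ℕ)

theorem rootBasis₂_apply (x y : PosRoot n) :
    rootBasis₂ R n (x, y) = Finsupp.single x 1 ⊗ₜ[R] Finsupp.single y 1 := by
  rw [rootBasis₂, Module.Basis.tensorProduct_apply, Finsupp.coe_basisSingleOne]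

theorem slPlusQ_S (x y : PosRoot n) :
    (slPlusQ q n).S (Finsupp.single x 1 ⊗ₜ[R] Finsupp.single y 1) =
      qcoef q x y • (Finsupp.single y 1 ⊗ₜ[R] Finsupp.single x 1) := by
  rw [← rootBasis₂_apply]
  exact Module.Basis.constr_basis _ _ _ _

theorem slPlusQ_br (x y : PosRoot n) :
    (slPlusQ q n).br (Finsupp.single x 1 ⊗ₜ[R] Finsupp.single y 1) = qBr q x y := by
  rw [← rootBasis₂_apply]
  exact Module.Basis.constr_basis _ _ _ _

theorem slPlusQ_pb (x y : PosRoot n) :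
    (slPlusQ q n).pb (Finsupp.single x 1 ⊗ₜ[R] Finsupp.single y 1) = qPb q x y := by
  rw [← rootBasis₂_apply]
  exact Module.Basis.constr_basis _ _ _ _

theorem slPlusQ_basis (x : PosRoot n) : (slPlusQ q n).basis x = Finsupp.single x 1 := by
  rw [slPlusQ, Finsupp.coe_basisSingleOne]

theorem single_mem_gr (x : PosRoot n) :
    Finsupp.single x (1 : R) ∈ (slPlusQ q n).gr x.deg :=
  Submodule.subset_span ⟨x, rfl, rfl⟩

theorem usualBr_mem_filtLT (x y : PosRoot n) :
    usualBr R x y ∈ (slPlusQ q n).filtLT (x.deg + y.deg) := by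
  rw [usualBr]
  refine sub_mem ?_ ?_
  · split_ifs with h
    · rw [show unit R x.row y.col = _ from unit_of_row_col (x.join y h)]
      exact mem_filtLT (deg_bracket_lt (z := x.join y h) h rfl rfl) (single_mem_gr q n _)
    · exact zero_mem _
  · split_ifs with h
    · rw [show unit R y.row x.col = _ from unit_of_row_col (y.join x h), add_comm]
      exact mem_filtLT (deg_bracket_lt (z := y.join x h) h rfl rfl) (single_mem_gr q n _)
    · exact zero_mem _

theorem qBr_mem_filtLT (x y : PosRoot n) :
    qBr q x y ∈ (slPlusQ q n).filtLT (x.deg + y.deg) := by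
  rw [qBr]
  split_ifs
  · exact usualBr_mem_filtLT q n x y
  · rw [add_comm]
    exact neg_mem (Submodule.smul_mem _ _ (usualBr_mem_filtLT q n y x))
  · exact zero_mem _

theorem unit_tmul_unit_mem_filtLT₂ {x y : PosRoot n} (h1 : x.row < y.row) (h2 : y.row < x.col)
    (h3 : x.col < y.col) : unit R x.row y.col ⊗ₜ[R] unit R y.row x.col ∈
      (slPlusQ q n).filtLT₂ (x.deg + y.deg) := by
  let z : PosRoot n := ⟨(x.row, y.col), x.row_lt_col.trans h3⟩
  let w : PosRoot n := ⟨(y.row, x.col), h2⟩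
  rw [show unit R x.row y.col = _ from unit_of_row_col z,
    show unit R y.row x.col = _ from unit_of_row_col w]
  exact tmul_mem_filtLT₂ (deg_crossing_lt (z := z) (w := w) h1 h2 h3 rfl rfl rfl rfl)
    (single_mem_gr q n z) (single_mem_gr q n w)

theorem qPb_mem_filtLT₂ (x y : PosRoot n) :
    qPb q x y ∈ (slPlusQ q n).filtLT₂ (x.deg + y.deg) := by
  rw [qPb]
  split_ifs with h h
  · exact Submodule.smul_mem _ _ (unit_tmul_unit_mem_filtLT₂ q n h.1 h.2.1 h.2.2)
  · rw [add_comm]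
    exact Submodule.smul_mem _ _ (unit_tmul_unit_mem_filtLT₂ q n h.1 h.2.1 h.2.2)
  · exact zero_mem _

variable {n} in
/-- The two root vectors in a nonzero value of the pseudobracket have bracket zero, since one is
nested in the other. -/
theorem br_unit_tmul_unit {x y : PosRoot n} (h2 : y.row < x.col)
    (h3 : x.col < y.col) :
    (slPlusQ q n).br (unit R x.row y.col ⊗ₜ[R] unit R y.row x.col) = 0 := by
  let z : PosRoot n := ⟨(x.row, y.col), x.row_lt_col.trans h3⟩
  let w : PosRoot n := ⟨(y.row, x.col), h2⟩
  rw [show unit R x.row y.col = _ from unit_of_row_col z,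
    show unit R y.row x.col = _ from unit_of_row_col w, slPlusQ_br]
  exact qBr_eq_zero q (x := z) (y := w) y.row_lt_col.ne' x.row_lt_col.ne'

theorem slPlusQ_mult_left {x y z : PosRoot n} (hxy : x < y) (hyz : y < z) :
    (slPlusQ q n).S (Finsupp.single x 1 ⊗ₜ[R] (slPlusQ q n).br
        (Finsupp.single y 1 ⊗ₜ[R] Finsupp.single z 1)) =
      (slPlusQ q n).brId ((slPlusQ q n).S23 ((slPlusQ q n).S12
        (Finsupp.single x 1 ⊗ₜ[R] (Finsupp.single y 1 ⊗ₜ[R] Finsupp.single z 1)))) := by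
  rw [slPlusQ_br, S12_tmul, slPlusQ_S, ← TensorProduct.smul_tmul', map_smul, map_smul,
    map_smul, TensorProduct.assoc_tmul, S23_tmul, slPlusQ_S, TensorProduct.tmul_smul, map_smul,
    brId_tmul, slPlusQ_br, qBr_of_lt q hyz, usualBr_of_lt hyz]
  split_ifs with h
  · rw [slPlusQ_S, qcoef_of_lt q (hxy.trans (lt_join h)), qcoef_of_lt q hxy,
      qcoef_of_lt q (hxy.trans hyz), cartan_join_right, zpow_add, Units.val_mul, smul_smul]
  · simp

theorem slPlusQ_mult_right {x y z : PosRoot n} (hxy : x < y) (hyz : y < z) :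
    (slPlusQ q n).S ((slPlusQ q n).br (Finsupp.single x 1 ⊗ₜ[R] Finsupp.single y 1) ⊗ₜ[R]
        Finsupp.single z 1) =
      (slPlusQ q n).idBr ((slPlusQ q n).S12 ((slPlusQ q n).S23
        (Finsupp.single x 1 ⊗ₜ[R] (Finsupp.single y 1 ⊗ₜ[R] Finsupp.single z 1)))) := by
  rw [slPlusQ_br, S23_tmul, slPlusQ_S, TensorProduct.tmul_smul, map_smul, map_smul,
    S12_tmul, slPlusQ_S, ← TensorProduct.smul_tmul', map_smul, map_smul, TensorProduct.assoc_tmul,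
    idBr_tmul, slPlusQ_br, qBr_of_lt q hxy, usualBr_of_lt hxy]
  split_ifs with h
  · rw [slPlusQ_S, qcoef_of_lt q ((join_lt h).trans hyz), qcoef_of_lt q hyz,
      qcoef_of_lt q (hxy.trans hyz), cartan_join_left, add_comm, zpow_add, Units.val_mul,
      smul_smul]
  · simp

theorem slPlusQ_br_assoc {x y z : PosRoot n} (hyx : y < x) (hzy : z < y) :
    (slPlusQ q n).br ((slPlusQ q n).br (Finsupp.single z 1 ⊗ₜ[R] Finsupp.single y 1) ⊗ₜ[R]
        Finsupp.single x 1) =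
      (slPlusQ q n).br (Finsupp.single z 1 ⊗ₜ[R] (slPlusQ q n).br
        (Finsupp.single y 1 ⊗ₜ[R] Finsupp.single x 1)) := by
  have hne : x.col ≠ z.row := col_ne_row_of_lt (hzy.trans hyx)
  -- both sides are the root vector with the row of `z` and the column of `x` when these roots can
  -- be joined through `y`
  trans if z.col = y.row ∧ y.col = x.row then unit R z.row x.col else 0
  · rw [slPlusQ_br, qBr_of_lt q hzy, usualBr_of_lt hzy]
    by_cases e : z.col = y.row
    · rw [dif_pos e, slPlusQ_br, qBr_of_lt q ((join_lt e).trans hyx), usualBr,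
        if_neg (show x.col ≠ (z.join y e).row from hne), sub_zero]
      exact if_congr ⟨fun h => ⟨e, h⟩, fun h => h.2⟩ rfl rfl
    · rw [dif_neg e, if_neg (by tauto), TensorProduct.zero_tmul, map_zero]
  · rw [slPlusQ_br q n y x, qBr_of_lt q hyx, usualBr_of_lt hyx]
    by_cases e : y.col = x.row
    · rw [dif_pos e, slPlusQ_br, qBr_of_lt q (hzy.trans (lt_join e)), usualBr,
        if_neg (show (y.join x e).col ≠ z.row from hne), sub_zero]
      exact if_congr ⟨fun h => h.1, fun h => ⟨h, e⟩⟩ rfl rfl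
    · rw [dif_neg e, if_neg (by tauto), TensorProduct.tmul_zero, map_zero]

theorem slPlusQ_br_outer {x y z : PosRoot n} (hyx : y < x) (hzy : z < y) :
    (slPlusQ q n).br (Finsupp.single y 1 ⊗ₜ[R] (slPlusQ q n).br
      (Finsupp.single z 1 ⊗ₜ[R] Finsupp.single x 1)) = 0 := by
  rw [slPlusQ_br q n z x, qBr_of_lt q (hzy.trans hyx), usualBr_of_lt (hzy.trans hyx)]
  split_ifs with e
  · rw [slPlusQ_br]
    exact qBr_eq_zero q (x := y) (y := z.join x e) (col_ne_row_of_lt hzy : y.col ≠ z.row)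
      (col_ne_row_of_lt hyx : x.col ≠ y.row)
  · rw [TensorProduct.tmul_zero, map_zero]

theorem slPlusQ_S_basis (x y : PosRoot n) :
    (slPlusQ q n).S ((slPlusQ q n).basis x ⊗ₜ[R] (slPlusQ q n).basis y) =
      qcoef q x y • ((slPlusQ q n).basis y ⊗ₜ[R] (slPlusQ q n).basis x) := by
  rw [slPlusQ_basis, slPlusQ_basis, slPlusQ_S]

theorem slPlusQ_br_skew (x y : PosRoot n) :
    qcoef q x y • (slPlusQ q n).br ((slPlusQ q n).basis y ⊗ₜ[R] (slPlusQ q n).basis x) =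
      -(slPlusQ q n).br ((slPlusQ q n).basis x ⊗ₜ[R] (slPlusQ q n).basis y) := by
  rw [slPlusQ_basis, slPlusQ_basis, slPlusQ_br, slPlusQ_br, qcoef_smul_qBr]

theorem slPlusQ_br_pb : (slPlusQ q n).br ∘ₗ (slPlusQ q n).pb = 0 :=
  (slPlusQ q n).ext_basis fun x y => by
    rw [LinearMap.comp_apply, slPlusQ_basis, slPlusQ_basis, slPlusQ_pb, LinearMap.zero_apply, qPb]
    split_ifs with h h
    · rw [map_smul, br_unit_tmul_unit q h.2.1 h.2.2, smul_zero]
    · rw [map_smul, br_unit_tmul_unit q h.2.1 h.2.2, smul_zero]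
    · exact map_zero _

theorem slPlusQ_isTLie : (slPlusQ q n).IsTLie where
  S_sq := S_sq_of_basis (slPlusQ_S_basis q n) (qcoef_mul_qcoef q)
  S_basis x y := ⟨qcoef q x y, slPlusQ_S_basis q n x y⟩
  mult_left := mult_left_of_basis fun x y z hxy hyz => by
    rw [slPlusQ_basis, slPlusQ_basis, slPlusQ_basis]
    exact slPlusQ_mult_left q n hxy hyz
  mult_right := mult_right_of_basis fun x y z hxy hyz => by
    rw [slPlusQ_basis, slPlusQ_basis, slPlusQ_basis]
    exact slPlusQ_mult_right q n hxy hyz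
  grading := by
    have := (Finsupp.basisSingleOne (R := R) (ι := PosRoot n)).isInternal_span_image PosRoot.deg
    rwa [Finsupp.coe_basisSingleOne] at this
  br_stable c d u hu v hv := by
    refine TensorProduct.map_tmul_mem (slPlusQ q n).br
      (b := fun x => Finsupp.single x (1 : R)) ?_ hu hv
    rintro x rfl y rfl
    rw [slPlusQ_br]
    exact qBr_mem_filtLT q n x y
  pb_stable c d u hu v hv := by
    refine TensorProduct.map_tmul_mem (slPlusQ q n).pb
      (b := fun x => Finsupp.single x (1 : R)) ?_ hu hv
    rintro x rfl y rfl
    rw [slPlusQ_pb]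
    exact qPb_mem_filtLT₂ q n x y
  T_eq := rfl
  br_T := br_T_of_br_S rfl (br_S_of_basis (slPlusQ_S_basis q n) (slPlusQ_br_skew q n))
    (slPlusQ_br_pb q n)
  pb_S := pb_S_of_basis (slPlusQ_S_basis q n) fun x y => by
    rw [slPlusQ_basis, slPlusQ_basis, slPlusQ_pb, slPlusQ_pb, qcoef_smul_qPb]
  br_pb := slPlusQ_br_pb q n
  jacobi := jacobi_of_assoc (slPlusQ_S_basis q n) (slPlusQ_br_skew q n)
    (fun x y z hyx hzy => by
      rw [slPlusQ_basis, slPlusQ_basis, slPlusQ_basis]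
      exact slPlusQ_br_assoc q n hyx hzy)
    (fun x y z hyx hzy => by
      rw [slPlusQ_basis, slPlusQ_basis, slPlusQ_basis]
      exact slPlusQ_br_outer q n hyx hzy)

end SlPlusQ

/-! ### Specialization at `t = 0` -/

section Classical

open TLieData PosRoot

variable (K : Type*) [Field K] (n : ℕ)

/-- The linear map from the free module on the positive roots to `sl_{n+1}^+` that matches the
bases. -/
noncomputable def rootToMatrix : (PosRoot n →₀ K) ≃ₗ[K] slPlus K n := (slPlusBasis K n).repr.symm

theorem rootToMatrix_single (x : PosRoot n) :
    rootToMatrix K n (Finsupp.single x 1) = slPlusBasis K n x := by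
  rw [rootToMatrix, Module.Basis.repr_symm_single_one]

theorem rootToMatrix_unit {i j : Fin (n + 1)} (h : i < j) :
    (rootToMatrix K n (unit K i j) : Matrix (Fin (n + 1)) (Fin (n + 1)) K) =
      Matrix.single i j 1 := by
  rw [unit_of_lt h, rootToMatrix_single, slPlusBasis_coe]
  rfl

theorem slPlus_lie (x y : PosRoot n) :
    ⁅slPlusBasis K n x, slPlusBasis K n y⁆ = rootToMatrix K n (usualBr K x y) := by
  apply Subtype.ext
  have key : ∀ x y : PosRoot n, (Matrix.single x.row x.col (1 : K) * Matrix.single y.row y.col 1) =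
      (rootToMatrix K n (if x.col = y.row then unit K x.row y.col else 0) :
        Matrix (Fin (n + 1)) (Fin (n + 1)) K) := by
    intro x y
    split_ifs with h
    · rw [rootToMatrix_unit K n (i := x.row) (j := y.col) (x.join y h).2, h,
        Matrix.single_mul_single_same, one_mul]
    · rw [Matrix.single_mul_single_of_ne _ _ _ _ h, map_zero]
      rfl
  rw [usualBr, map_sub]
  change (slPlusBasis K n x : Matrix (Fin (n + 1)) (Fin (n + 1)) K) * slPlusBasis K n y
    - (slPlusBasis K n y : Matrix (Fin (n + 1)) (Fin (n + 1)) K) * slPlusBasis K n x = _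
  rw [slPlusBasis_coe, slPlusBasis_coe, key, key]
  rfl

theorem slPlus_isTLie : (classical (slPlusBasis K n) (PosRoot.deg (n := n))).IsTLie := by
  refine classical_isTLie _ _ fun x y => ?_
  rw [slPlus_lie, usualBr, map_sub]
  have key : ∀ x y : PosRoot n, rootToMatrix K n (if x.col = y.row then unit K x.row y.col else 0) ∈
      (classical (slPlusBasis K n) (PosRoot.deg (n := n))).filtLT (x.deg + y.deg) := by
    intro x y
    split_ifs with h
    · rw [show unit K x.row y.col = _ from unit_of_row_col (x.join y h), rootToMatrix_single]
      exact mem_filtLT (deg_bracket_lt (z := x.join y h) h rfl rfl)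
        (Submodule.subset_span ⟨_, rfl, rfl⟩)
    · rw [map_zero]
      exact zero_mem _
  exact sub_mem (key x y) (add_comm y.deg x.deg ▸ key y x)

end Classical

section BaseChange

open TLieData PosRoot

namespace TLieData

variable {R ι L : Type*} [CommRing R] [LinearOrder ι] [AddCommGroup L] [Module R L]
  (A : Type*) [CommRing A] [Algebra R A] (D : TLieData R ι L)

theorem baseChange_basis (x : ι) : (D.baseChange A).basis x = 1 ⊗ₜ[R] D.basis x :=
  Module.Basis.baseChange_apply _ _ _

local notation "distrib" => TensorProduct.AlgebraTensorModule.distribBaseChange R A L L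

theorem baseChange_S_tmul (u v : L) : (D.baseChange A).S ((1 ⊗ₜ[R] u) ⊗ₜ[A] (1 ⊗ₜ[R] v)) =
    distrib (1 ⊗ₜ[R] D.S (u ⊗ₜ[R] v)) := by
  rw [← TensorProduct.AlgebraTensorModule.distribBaseChange_tmul]
  simp only [baseChange, LinearMap.comp_apply, LinearEquiv.coe_coe, LinearEquiv.symm_apply_apply,
    LinearMap.baseChange_tmul]

theorem baseChange_pb_tmul (u v : L) : (D.baseChange A).pb ((1 ⊗ₜ[R] u) ⊗ₜ[A] (1 ⊗ₜ[R] v)) =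
    distrib (1 ⊗ₜ[R] D.pb (u ⊗ₜ[R] v)) := by
  rw [← TensorProduct.AlgebraTensorModule.distribBaseChange_tmul]
  simp only [baseChange, LinearMap.comp_apply, LinearEquiv.coe_coe, LinearEquiv.symm_apply_apply,
    LinearMap.baseChange_tmul]

theorem baseChange_br_tmul (u v : L) : (D.baseChange A).br ((1 ⊗ₜ[R] u) ⊗ₜ[A] (1 ⊗ₜ[R] v)) =
    1 ⊗ₜ[R] D.br (u ⊗ₜ[R] v) := by
  rw [← TensorProduct.AlgebraTensorModule.distribBaseChange_tmul]
  simp only [baseChange, LinearMap.comp_apply, LinearEquiv.coe_coe, LinearEquiv.symm_apply_apply,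
    LinearMap.baseChange_tmul]

end TLieData

variable {R : Type*} [CommRing R] (q : Rˣ) (n : ℕ) (K : Type*) [Field K] [Algebra R K]

/-- The specialization of the free module on the positive roots, identified with `sl_{n+1}^+`. -/
noncomputable def specialize : (K ⊗[R] (PosRoot n →₀ R)) ≃ₗ[K] slPlus K n :=
  ((slPlusQ q n).basis.baseChange K).equiv (slPlusBasis K n) (Equiv.refl _)

theorem specialize_basis (x : PosRoot n) :
    specialize q n K (1 ⊗ₜ[R] Finsupp.single x 1) = slPlusBasis K n x := by
  rw [← slPlusQ_basis q, ← Module.Basis.baseChange_apply]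
  exact Module.Basis.equiv_apply _ _ _ _

theorem specialize_unit (i j : Fin (n + 1)) :
    specialize q n K (1 ⊗ₜ[R] unit R i j) = rootToMatrix K n (unit K i j) := by
  by_cases h : i < j
  · rw [unit_of_lt h, unit_of_lt h, specialize_basis, rootToMatrix_single]
  · rw [unit, unit, dif_neg h, dif_neg h, TensorProduct.tmul_zero, map_zero, map_zero]

theorem specialize_usualBr (x y : PosRoot n) :
    specialize q n K (1 ⊗ₜ[R] usualBr R x y) = ⁅slPlusBasis K n x, slPlusBasis K n y⁆ := by
  rw [slPlus_lie, usualBr, usualBr, TensorProduct.tmul_sub, map_sub, map_sub]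
  congr 1 <;> split_ifs
  · exact specialize_unit q n K _ _
  · rw [TensorProduct.tmul_zero, map_zero, map_zero]
  · exact specialize_unit q n K _ _
  · rw [TensorProduct.tmul_zero, map_zero, map_zero]

variable {q}

theorem algebraMap_inv_of_eq_one (hq : algebraMap R K q = 1) :
    algebraMap R K ((q⁻¹ : Rˣ) : R) = 1 := by
  have h := map_mul (algebraMap R K) (q : R) ((q⁻¹ : Rˣ) : R)
  rw [Units.mul_inv, map_one, hq, one_mul] at h
  exact h.symm

theorem algebraMap_qcoef (hq : algebraMap R K q = 1) (x y : PosRoot n) :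
    algebraMap R K (qcoef q x y) = 1 := by
  have h : Units.map (algebraMap R K).toMonoidHom q = 1 := Units.ext hq
  have h' : ∀ z : ℤ, algebraMap R K ((q ^ z : Rˣ) : R) = 1 := fun z => by
    have := congrArg Units.val (map_zpow (Units.map (algebraMap R K).toMonoidHom) q z)
    rw [h, one_zpow] at this
    exact this
  rw [qcoef]
  split_ifs
  · exact h' _
  · exact h' _
  · exact map_one _

theorem specialize_qBr (hq : algebraMap R K q = 1) (x y : PosRoot n) :
    specialize q n K (1 ⊗ₜ[R] qBr q x y) = ⁅slPlusBasis K n x, slPlusBasis K n y⁆ := by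
  rcases lt_trichotomy x y with h | rfl | h
  · rw [qBr_of_lt q h, specialize_usualBr]
  · rw [qBr_self, TensorProduct.tmul_zero, map_zero, lie_self]
  · rw [qBr_of_gt q h, TensorProduct.tmul_neg, map_neg, TensorProduct.tmul_smul,
      ← algebraMap_smul K, algebraMap_qcoef n K hq, one_smul, specialize_usualBr, lie_skew]

theorem one_tmul_qPb (hq : algebraMap R K q = 1) (x y : PosRoot n) :
    (1 : K) ⊗ₜ[R] qPb q x y = 0 := by
  rw [qPb]
  split_ifs
  · rw [TensorProduct.tmul_smul, ← algebraMap_smul K, map_sub, hq, algebraMap_inv_of_eq_one K hq,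
      sub_self, zero_smul]
  · rw [TensorProduct.tmul_smul, ← algebraMap_smul K, map_sub, hq, algebraMap_inv_of_eq_one K hq,
      sub_self, zero_smul]
  · exact TensorProduct.tmul_zero _ _

theorem map_specialize_gr (d : ℕ) :
    (((slPlusQ q n).baseChange K).gr d).map (specialize q n K).toLinearMap =
      (classical (slPlusBasis K n) (PosRoot.deg (n := n))).gr d := by
  change Submodule.map _ (Submodule.baseChange K (Submodule.span R _)) = Submodule.span K _
  rw [Submodule.baseChange_span, Submodule.map_span, Set.image_image, Set.image_image]
  congr 1
  refine Set.image_congr fun x _ => ?_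
  exact specialize_basis q n K x

theorem specialize_isMorphism (hq : algebraMap R K q = 1) : IsMorphism ((slPlusQ q n).baseChange K)
    (classical (slPlusBasis K n) (PosRoot.deg (n := n))) (specialize q n K).toLinearMap where
  map_gr d := (map_specialize_gr n K d).le
  map_br := ((slPlusQ q n).baseChange K).ext_basis fun x y => by
    rw [LinearMap.comp_apply, LinearMap.comp_apply, baseChange_basis, baseChange_basis,
      baseChange_br_tmul, slPlusQ_basis, slPlusQ_basis, slPlusQ_br, TensorProduct.map_tmul]
    simp only [LinearEquiv.coe_coe]
    rw [specialize_qBr n K hq, specialize_basis, specialize_basis]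
    rfl
  map_pb := ((slPlusQ q n).baseChange K).ext_basis fun x y => by
    rw [LinearMap.comp_apply, LinearMap.comp_apply, baseChange_basis, baseChange_basis,
      baseChange_pb_tmul, slPlusQ_basis, slPlusQ_basis, slPlusQ_pb, one_tmul_qPb n K hq, map_zero,
      map_zero]
    rfl
  map_S := ((slPlusQ q n).baseChange K).ext_basis fun x y => by
    rw [LinearMap.comp_apply, LinearMap.comp_apply, baseChange_basis, baseChange_basis,
      baseChange_S_tmul, slPlusQ_basis, slPlusQ_basis, slPlusQ_S, TensorProduct.tmul_smul,
      ← algebraMap_smul K, algebraMap_qcoef n K hq, one_smul,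
      TensorProduct.AlgebraTensorModule.distribBaseChange_tmul]
    rfl

theorem slPlusQ_isDeformation (hq : algebraMap R K q = 1) : IsDeformation (slPlusQ q n)
    (classical (slPlusBasis K n) (PosRoot.deg (n := n))) :=
  ⟨slPlusQ_isTLie q n, slPlus_isTLie K n, specialize q n K,
    fun x => by rw [slPlusQ_basis, specialize_basis]; rfl,
    specialize_isMorphism n K hq,
    (specialize_isMorphism n K hq).symm fun d => (map_specialize_gr n K d).ge⟩

end BaseChange

theorem mainTheorem5 (K : Type*) [Field K] [CharZero K] (n : ℕ) :
    ((∃ b : Module.Basis (NondecSeq n) (QRing K) (UqPlus K n), ∀ l : NondecSeq n,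
        b l = (l.1.map (rootVector (((qUnit K)⁻¹ : (QRing K)ˣ) : QRing K) (UqPlus.gen K n))).prod) ∧
      (∃ b : Module.Basis (NondecSeq n) (QField K) (UqPlusField K n), ∀ l : NondecSeq n,
        b l = (l.1.map (rootVector (((qUnitField K)⁻¹ : (QField K)ˣ) : QField K)
          (UqPlusField.gen K n))).prod)) ∧
    TLieData.IsDeformation (slPlusQ (qUnit K) n)
      (TLieData.classical (slPlusBasis K n) (PosRoot.deg (n := n))) :=
  ⟨⟨UqPlus.exists_basis K n, UqPlusField.exists_basis K n⟩,
    slPlusQ_isDeformation n K (atZero_qUnit K)⟩
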